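/- Let $\alpha<\beta$ be real numbers. For an even integer $p\ge 2$ and a set $S\subset[p]=\{1,\dots,p\}$ with $|S|=p/2$ and complement $\bar S$, write $i\sim j$ if $i,j$ lie both in $S$ or both in $\bar S$, and $i\nsim j$ otherwise. Let $\mathbb P_{S}$ be the probability distribution on $\{-1,1\}^p$ (Ising blockmodel) with $$\mathbb P_{S}(\sigma)=\frac1{Z}\exp\Big[\frac{\beta}{2p}\sum_{i\sim j}\sigma_i\sigma_j+\frac{\alpha}{2p}\sum_{i\nsim j}\sigma_i\sigma_j\Big],$$ where the sums run over ordered pairs $(i,j)\in[p]^2$ and $Z$ is the normalizing constant. Given independent observations $\sigma^{(1)},\dots,\sigma^{(n)}$ from $\mathbb P_{S}$, put $\hat\Sigma=\frac1n\sum_{t=1}^n\sigma^{(t)}\sigma^{(t)\top}$, $P=I_p-\frac1p\mathbf 1\mathbf 1^\top$, $\hat\Gamma=P\hat\Sigma P$, and consider the semidefinite program $$\max_{V\in\mathcal E}\operatorname{Tr}(\hat\Gamma V),\qquad \mathcal E=\{V\in\mathbb R^{p\times p}: V=V^\top,\ V\succeq 0,\ V_{ii}=1\text{ for all } i\}.$$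 The program is said to recover $(S,\bar S)$ exactly if $v_Sv_S^\top$ is its unique solution, where $v_S=\mathbf 1_S-\mathbf 1_{\bar S}$. Then there are positive constants $C_1,C_2$ depending only on $\alpha$ and $\beta$ such that for every even $p\ge2$, every $S\subset[p]$ with $|S|=p/2$, every $\delta\in(0,1)$ and every integer $n\ge 0$, the program recovers $(S,\bar S)$ exactly with probability at least $1-\delta$ whenever 1. $n\ge C_1\,p\log(p/\delta)$, if $\beta+|\alpha|<2$ or $\alpha>0$; 2. $n\ge C_2\log(p/\delta)$ otherwise, provided that $\beta+|\alpha|\ne2$. In particular, if $\beta-\alpha>2$ and $\alpha\le0$, then $n\ge C_2\log(p/\delta)$ observations, a number logarithmic in the dimension $p$, suffice to recover the blocks exactly with probability at least $1-\delta$. -/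

import Mathlib

open MeasureTheory

noncomputable section

namespace IsingBlock

/-- Spin configurations `σ ∈ {-1, 1}^p`; the group `ℤˣ` of units of `ℤ` is `{1, -1}`. -/
abbrev Config (p : ℕ) : Type := Fin p → ℤˣ

instance measurableSingletonClass_spin : MeasurableSingletonClass ℤˣ :=
  ⟨fun u => ⟨{(u : ℤ)}, trivial, by ext v; simp [Units.ext_iff]⟩⟩

/-- The spin `σ_i`, as a real number. -/
def spin {p : ℕ} (σ : Config p) (i : Fin p) : ℝ := ((σ i : ℤ) : ℝ)

/-- The exponent
`(β / 2p) ∑_{i ∼ j} σ_i σ_j + (α / 2p) ∑_{i ≁ j} σ_i σ_j`, the sums being over ordered pairs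
`(i, j)`, where `i ∼ j` means that `i` and `j` are both in `S` or both in its complement. -/
def exponent {p : ℕ} (S : Finset (Fin p)) (α β : ℝ) (σ : Config p) : ℝ :=
  β / (2 * p) * (∑ i, ∑ j, if (i ∈ S ↔ j ∈ S) then spin σ i * spin σ j else 0) +
    α / (2 * p) * (∑ i, ∑ j, if (i ∈ S ↔ j ∈ S) then 0 else spin σ i * spin σ j)

/-- The partition function `Z_{S, α, β}`. -/
def partitionFunction {p : ℕ} (S : Finset (Fin p)) (α β : ℝ) : ℝ :=
  ∑ σ : Config p, Real.exp (exponent S α β σ)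

/-- The density `f_{S, α, β}` with respect to the counting measure on `{-1, 1}^p`. -/
def density {p : ℕ} (S : Finset (Fin p)) (α β : ℝ) (σ : Config p) : ℝ :=
  Real.exp (exponent S α β σ) / partitionFunction S α β

/-- The distribution `ℙ_{S, α, β}` of the Ising blockmodel on `{-1, 1}^p`. -/
def ibm {p : ℕ} (S : Finset (Fin p)) (α β : ℝ) : Measure (Config p) :=
  Measure.count.withDensity fun σ => ENNReal.ofReal (density S α β σ)

/-- The law of `n` independent observations `σ⁽¹⁾, …, σ⁽ⁿ⁾` from `ℙ_{S, α, β}`. -/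
def sampleLaw {p : ℕ} (n : ℕ) (S : Finset (Fin p)) (α β : ℝ) : Measure (Fin n → Config p) :=
  Measure.pi fun _ => ibm S α β

theorem partitionFunction_pos {p : ℕ} (S : Finset (Fin p)) (α β : ℝ) :
    0 < partitionFunction S α β :=
  Finset.sum_pos (fun _ _ => Real.exp_pos _) Finset.univ_nonempty

instance isProbabilityMeasure_ibm {p : ℕ} (S : Finset (Fin p)) (α β : ℝ) :
    IsProbabilityMeasure (ibm S α β) := by
  constructor
  have hZ := partitionFunction_pos S α β
  have hd : ∀ σ : Config p, 0 ≤ density S α β σ :=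
    fun σ => div_nonneg (Real.exp_pos _).le hZ.le
  rw [ibm, withDensity_apply _ MeasurableSet.univ, Measure.restrict_univ, lintegral_count,
    tsum_fintype, ← ENNReal.ofReal_sum_of_nonneg (fun σ _ => hd σ)]
  simp only [density]
  rw [← Finset.sum_div, ← partitionFunction, div_self hZ.ne', ENNReal.ofReal_one]

instance isProbabilityMeasure_sampleLaw {p : ℕ} (n : ℕ) (S : Finset (Fin p)) (α β : ℝ) :
    IsProbabilityMeasure (sampleLaw n S α β) := by
  unfold sampleLaw
  infer_instance

/-- The sample covariance matrix `Σ̂ = (1/n) ∑_t σ⁽ᵗ⁾ σ⁽ᵗ⁾ᵀ`. -/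
def sampleCov {p n : ℕ} (x : Fin n → Config p) : Matrix (Fin p) (Fin p) ℝ :=
  (1 / (n : ℝ)) • ∑ t, Matrix.vecMulVec (spin (x t)) (spin (x t))

/-- The centering projector `P = I_p - (1/p) 𝟏 𝟏ᵀ`. -/
def centering (p : ℕ) : Matrix (Fin p) (Fin p) ℝ :=
  1 - (1 / (p : ℝ)) • Matrix.vecMulVec (fun _ => 1) (fun _ => 1)

/-- The sample covariance matrix `Γ̂ = P Σ̂ P` of the centered observations. -/
def centeredCov {p n : ℕ} (x : Fin n → Config p) : Matrix (Fin p) (Fin p) ℝ :=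
  centering p * sampleCov x * centering p

/-- The elliptope: symmetric positive semidefinite matrices with unit diagonal. -/
def elliptope (p : ℕ) : Set (Matrix (Fin p) (Fin p) ℝ) :=
  {V | V.PosSemidef ∧ ∀ i, V i i = 1}

/-- The set of solutions of the semidefinite program
`maximize Tr(Γ̂ V) over V in the elliptope`. -/
def sdpSolutions {p n : ℕ} (x : Fin n → Config p) : Set (Matrix (Fin p) (Fin p) ℝ) :=
  {V ∈ elliptope p | IsMaxOn (fun W => (centeredCov x * W).trace) (elliptope p) V}

/-- The vector `v_S = 𝟏_S - 𝟏_{S̄}`. -/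
def blockVec {p : ℕ} (S : Finset (Fin p)) (i : Fin p) : ℝ := if i ∈ S then 1 else -1

/-- The semidefinite program recovers the partition `(S, S̄)` exactly:
`v_S v_Sᵀ` is its unique solution. -/
def SDPRecovers {p n : ℕ} (S : Finset (Fin p)) (x : Fin n → Config p) : Prop :=
  sdpSolutions x = {Matrix.vecMulVec (blockVec S) (blockVec S)}

end IsingBlock

end

/-!
Write `v = v_S`, `M = ∑ σ_i` for the magnetization and `w = v · σ` for the block contrast. The
exponent is `(β + α) / (4p) M² + (β - α) / (4p) w²`.

**Certificate.** By semidefinite duality (`maximizers_eq_singleton_of_dual`), `v vᵀ` is the unique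
solution as soon as `D - Γ̂` is positive definite on `v^⊥`, where `D` is the diagonal matrix with
`Γ̂ v = D v`. On `v^⊥` the centered observations act through their residuals `z`, the projections of
`σ` orthogonal to both `𝟏` and `v`. So it suffices that every `D_ii`, an average of the variables
`certEntry`, exceeds the largest eigenvalue of the empirical second moment of `z`
(`sdpRecovers_of_certificate`).

**Population gap.** By exchangeability the covariance is `s I + η 𝟏𝟏ᵀ + g v vᵀ`. The mean of `D_ii`
is `s + p g`, and `z` has variance at most `s` in every direction, so the gap is `p g`. It is
bounded below for all `α < β` (`exists_isCovariance`): take two pairs of sites, each with one site in either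
block. Exchanging the spins inside a pair preserves `M` and shifts `w` by `± 4`, and convexity of
`exp ((β - α) / (4p) w²)` makes the two pairs positively correlated, by an amount of order `1 / p`.
For `α ≤ 0` and `β - α > 2` the gap is of order `p`, since `E w²` is of order `p²`
(`exists_mul_sq_le_expect_contrast_sq`). This follows from the variational principle: a product
measure with a small magnetization along `v` has larger free energy than the uniform measure, so the
mean energy is of order `p`, and `E M² ≤ E w²` when `α ≤ 0`.

**Concentration.** The entries of `D` satisfy a relative Chernoff bound, because they are bounded by
`2p` and their second moment is at most `4p` times their mean (`sampleLaw_certEntry_le`). The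
residuals are sub-Gaussian in every direction: given the spin sums of the blocks the spins of a
block are exchangeable, and revealing them one at a time gives increments whose squares sum to the
empirical variance of the coefficients (`sum_mul_exp_linear_le`). The largest eigenvalue is then
controlled by integrating the exponential moment of the quadratic form over a ball
(`sampleLaw_exists_residual_gt_le`), at the price of a factor `((1 + r) / r) ^ p`.

With a constant gap both estimates need order `p log (p / δ)` observations; with a gap of order `p`
they need order `log (p / δ)` once `p` is large, and in bounded dimension the first bound applies.
-/

namespace IsingBlock

/-! ### The dual certificate -/

open Matrix in
/-- The quadratic form of `diag D - Γ` is constant along the direction `v`, a kernel vector. -/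
theorem slack_eq_of_add_smul {p : ℕ} {Γ : Matrix (Fin p) (Fin p) ℝ} (hΓ : Γ.IsSymm)
    {v D : Fin p → ℝ} (hL : ∀ i, (Γ *ᵥ v) i = D i * v i) (u : Fin p → ℝ) (c : ℝ) :
    (∑ i, D i * (u + c • v) i ^ 2) - (u + c • v) ⬝ᵥ Γ *ᵥ (u + c • v) =
      (∑ i, D i * u i ^ 2) - u ⬝ᵥ Γ *ᵥ u := by
  have h1 : u ⬝ᵥ Γ *ᵥ v = ∑ i, D i * u i * v i := by
    simp only [dotProduct, hL]
    exact Finset.sum_congr rfl fun i _ => by ring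
  have h2 : v ⬝ᵥ Γ *ᵥ u = ∑ i, D i * u i * v i := by
    rw [← h1, dotProduct_mulVec, ← mulVec_transpose, hΓ, dotProduct_comm]
  have h3 : v ⬝ᵥ Γ *ᵥ v = ∑ i, D i * v i * v i := by
    simp only [dotProduct, hL]
    exact Finset.sum_congr rfl fun i _ => by ring
  have h4 : (∑ i, D i * (u + c • v) i ^ 2) = (∑ i, D i * u i ^ 2) +
      2 * c * (∑ i, D i * u i * v i) + c ^ 2 * ∑ i, D i * v i * v i := by
    rw [Finset.mul_sum, Finset.mul_sum, ← Finset.sum_add_distrib, ← Finset.sum_add_distrib]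
    refine Finset.sum_congr rfl fun i _ => ?_
    simp only [Pi.add_apply, Pi.smul_apply, smul_eq_mul]
    ring
  rw [h4]
  simp only [mulVec_add, mulVec_smul, dotProduct_add, add_dotProduct, smul_dotProduct,
    dotProduct_smul, smul_eq_mul, h1, h2, h3]
  ring

open Matrix in
/-- Dual certificate: if `diag D - Γ` annihilates the sign vector `v` and is positive definite on
`v^⊥`, then `v vᵀ` is the only maximizer of `V ↦ Tr (Γ V)` over the elliptope. -/
theorem maximizers_eq_singleton_of_dual {p : ℕ} (hp : 0 < p) {Γ : Matrix (Fin p) (Fin p) ℝ}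
    (hΓ : Γ.IsSymm) {v D : Fin p → ℝ} (hv : ∀ i, v i * v i = 1)
    (hL : ∀ i, (Γ *ᵥ v) i = D i * v i)
    (hpos : ∀ u : Fin p → ℝ, u ⬝ᵥ v = 0 → u ≠ 0 → u ⬝ᵥ Γ *ᵥ u < ∑ i, D i * u i ^ 2) :
    {V ∈ elliptope p | IsMaxOn (fun W => (Γ * W).trace) (elliptope p) V} = {vecMulVec v v} := by
  have hp' : (p : ℝ) ≠ 0 := by positivity
  have hvv : v ⬝ᵥ v = p := by simp [dotProduct, hv]
  have htr : ∀ x : Fin p → ℝ, (Γ * vecMulVec x x).trace = x ⬝ᵥ Γ *ᵥ x := by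
    intro x
    rw [mul_vecMulVec, trace_vecMulVec, dotProduct_comm]
  have hq : ∀ u : Fin p → ℝ, u ⬝ᵥ Γ *ᵥ u ≤ ∑ i, D i * u i ^ 2 ∧
      (u ⬝ᵥ Γ *ᵥ u = ∑ i, D i * u i ^ 2 → ∃ c : ℝ, u = c • v) := by
    intro u
    set c : ℝ := (u ⬝ᵥ v) / p
    have hu : u = (u - c • v) + c • v := by simp
    have horth : (u - c • v) ⬝ᵥ v = 0 := by
      rw [sub_dotProduct, smul_dotProduct, hvv, smul_eq_mul, div_mul_cancel₀ _ hp', sub_self]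
    have hs := slack_eq_of_add_smul hΓ hL (u - c • v) c
    rw [← hu] at hs
    by_cases h0 : u - c • v = 0
    · have : (∑ i, D i * u i ^ 2) - u ⬝ᵥ Γ *ᵥ u = 0 := by rw [hs, h0]; simp
      exact ⟨by linarith, fun _ => ⟨c, sub_eq_zero.1 h0⟩⟩
    · have := hpos _ horth h0
      exact ⟨by linarith, fun h => by linarith⟩
  have hvE : vecMulVec v v ∈ elliptope p := by
    refine ⟨?_, fun i => by simp [vecMulVec_apply, hv]⟩
    simpa using posSemidef_vecMulVec_self_star v
  have hvtr : (Γ * vecMulVec v v).trace = ∑ i, D i := by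
    rw [htr]
    simp only [dotProduct, hL]
    exact Finset.sum_congr rfl fun i _ => by rw [mul_left_comm, hv, mul_one]
  have hmain : ∀ V ∈ elliptope p, (Γ * V).trace ≤ ∑ i, D i ∧
      ((Γ * V).trace = ∑ i, D i → V = vecMulVec v v) := by
    rintro V ⟨hV, hd⟩
    obtain ⟨m, x, hx⟩ := posSemidef_iff_eq_sum_vecMulVec.1 hV
    simp only [star_trivial] at hx
    have e1 : (Γ * V).trace = ∑ k, x k ⬝ᵥ Γ *ᵥ x k := by
      rw [hx, Finset.mul_sum, trace_sum]
      simp only [htr]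
    have e2 : ∑ i, D i = ∑ k, ∑ i, D i * x k i ^ 2 := by
      rw [Finset.sum_comm]
      refine Finset.sum_congr rfl fun i _ => ?_
      rw [← Finset.mul_sum]
      have := hd i
      rw [hx, Matrix.sum_apply] at this
      simp only [vecMulVec_apply, ← pow_two] at this
      rw [this, mul_one]
    rw [e1, e2]
    refine ⟨Finset.sum_le_sum fun k _ => (hq (x k)).1, fun h => ?_⟩
    rw [Finset.sum_eq_sum_iff_of_le fun k _ => (hq (x k)).1] at h
    choose c hc using fun k => (hq (x k)).2 (h k (Finset.mem_univ k))
    have hVij : ∀ i j, V i j = (∑ k, c k ^ 2) * (v i * v j) := by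
      intro i j
      rw [hx, Matrix.sum_apply, Finset.sum_mul]
      refine Finset.sum_congr rfl fun k _ => ?_
      rw [vecMulVec_apply, hc k]
      simp only [Pi.smul_apply, smul_eq_mul]
      ring
    have h1 := hd ⟨0, hp⟩
    rw [hVij, hv, mul_one] at h1
    ext i j
    rw [hVij, h1, one_mul, vecMulVec_apply]
  ext V
  simp only [Set.mem_ofPred_eq, Set.mem_singleton_iff]
  constructor
  · rintro ⟨hV, hmax⟩
    have := isMaxOn_iff.1 hmax _ hvE
    rw [hvtr] at this
    exact (hmain V hV).2 (le_antisymm (hmain V hV).1 this)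
  · rintro rfl
    refine ⟨hvE, isMaxOn_iff.2 fun W hW => ?_⟩
    rw [hvtr]
    exact (hmain W hW).1

/-- The total magnetization `∑ σ_i`. -/
def magnetization {p : ℕ} (σ : Config p) : ℝ := ∑ i, spin σ i

/-- The block contrast `v_S · σ`. -/
def contrast {p : ℕ} (S : Finset (Fin p)) (σ : Config p) : ℝ := ∑ i, blockVec S i * spin σ i

/-- The projection of `σ` onto the orthogonal complement of `𝟏` and `v_S`, when `|S| = p / 2`. -/
noncomputable def residual {p : ℕ} (S : Finset (Fin p)) (σ : Config p) (i : Fin p) : ℝ :=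
  spin σ i - magnetization σ / p - contrast S σ / p * blockVec S i

/-- The contribution of the observation `σ` to the `i`-th diagonal entry of the dual certificate:
`v_i (Pσ)_i (v · σ)`. -/
noncomputable def certEntry {p : ℕ} (S : Finset (Fin p)) (i : Fin p) (σ : Config p) : ℝ :=
  blockVec S i * (spin σ i - magnetization σ / p) * contrast S σ

theorem blockVec_mul_self {p : ℕ} (S : Finset (Fin p)) (i : Fin p) :
    blockVec S i * blockVec S i = 1 := by
  unfold blockVec; split_ifs <;> norm_num

theorem sum_blockVec {p : ℕ} {S : Finset (Fin p)} (hS : 2 * S.card = p) :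
    ∑ i, blockVec S i = 0 := by
  simp only [blockVec]
  rw [Finset.sum_ite]
  have h1 : (Finset.univ.filter fun i => i ∈ S) = S := by simp
  have h2 : (Finset.univ.filter fun i => i ∉ S) = Sᶜ := by ext; simp
  rw [h1, h2]
  simp only [Finset.sum_const, Finset.card_compl, Fintype.card_fin, nsmul_eq_mul]
  have : p - S.card = S.card := by omega
  rw [this]; ring

open Matrix in
theorem centering_mulVec {p : ℕ} (x : Fin p → ℝ) (i : Fin p) :
    (centering p *ᵥ x) i = x i - (∑ j, x j) / p := by
  simp [centering, sub_mulVec, smul_mulVec, vecMulVec_mulVec, dotProduct, div_eq_inv_mul]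

theorem centering_isSymm (p : ℕ) : (centering p).IsSymm := by
  unfold Matrix.IsSymm centering
  rw [Matrix.transpose_sub, Matrix.transpose_smul, Matrix.transpose_one, Matrix.transpose_vecMulVec]

open Matrix in
theorem centeredCov_eq {p n : ℕ} (x : Fin n → Config p) :
    centeredCov x = (1 / (n : ℝ)) • ∑ t, vecMulVec (fun i => spin (x t) i - magnetization (x t) / p)
      (fun i => spin (x t) i - magnetization (x t) / p) := by
  unfold centeredCov sampleCov
  rw [mul_smul_comm, smul_mul_assoc, Finset.mul_sum, Finset.sum_mul]
  congr 1
  refine Finset.sum_congr rfl fun t _ => ?_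
  have h : centering p *ᵥ spin (x t) = fun i => spin (x t) i - magnetization (x t) / p := by
    ext i; rw [centering_mulVec]; rfl
  rw [mul_vecMulVec, vecMulVec_mul, ← mulVec_transpose, centering_isSymm, h]

open Matrix in
/-- Deterministic criterion: on `v^⊥` the centered observations and the residuals have the same
inner products, so it suffices that every diagonal entry of the dual certificate exceeds a bound
`τ` for the quadratic form of the residuals. -/
theorem sdpRecovers_of_certificate {p n : ℕ} (hn : 0 < n) {S : Finset (Fin p)} (hp : 0 < p)
    (hS : 2 * S.card = p) (x : Fin n → Config p) (τ : ℝ)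
    (hD : ∀ i, τ < ∑ t, certEntry S i (x t))
    (hR : ∀ u : Fin p → ℝ, ∑ t, (∑ i, u i * residual S (x t) i) ^ 2 ≤ τ * ∑ i, u i ^ 2) :
    SDPRecovers S x := by
  have hn' : (0 : ℝ) < 1 / n := by positivity
  set y : Fin n → Fin p → ℝ := fun t i => spin (x t) i - magnetization (x t) / p with hy
  have hyv : ∀ t, y t ⬝ᵥ blockVec S = contrast S (x t) := by
    intro t
    simp only [hy, dotProduct, sub_mul, Finset.sum_sub_distrib, ← Finset.mul_sum, sum_blockVec hS,
      mul_zero, sub_zero, contrast]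
    exact Finset.sum_congr rfl fun i _ => mul_comm _ _
  have hmul : ∀ u i, (centeredCov x *ᵥ u) i = 1 / n * ∑ t, y t i * (y t ⬝ᵥ u) := by
    intro u i
    rw [centeredCov_eq, smul_mulVec, sum_mulVec, Pi.smul_apply, Finset.sum_apply, smul_eq_mul]
    congr 1
    refine Finset.sum_congr rfl fun t _ => ?_
    rw [vecMulVec_mulVec]
    simp [hy]
  unfold SDPRecovers sdpSolutions
  refine maximizers_eq_singleton_of_dual hp (D := fun i => 1 / n * ∑ t, certEntry S i (x t)) ?_
    (blockVec_mul_self S) ?_ ?_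
  · rw [centeredCov_eq]
    unfold Matrix.IsSymm
    rw [transpose_smul, transpose_sum]
    simp only [transpose_vecMulVec]
  · intro i
    rw [hmul, mul_assoc, Finset.sum_mul]
    congr 1
    refine Finset.sum_congr rfl fun t _ => ?_
    rw [hyv, certEntry]
    linear_combination -(y t i * contrast S (x t)) * blockVec_mul_self S i
  · intro u huv hu
    have hyu : ∀ t, y t ⬝ᵥ u = ∑ i, u i * residual S (x t) i := by
      intro t
      have : ∑ i, u i * residual S (x t) i =
          y t ⬝ᵥ u - contrast S (x t) / p * (u ⬝ᵥ blockVec S) := by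
        simp only [dotProduct, Finset.mul_sum, ← Finset.sum_sub_distrib, hy, residual]
        exact Finset.sum_congr rfl fun i _ => by ring
      rw [this, huv, mul_zero, sub_zero]
    have e1 : u ⬝ᵥ centeredCov x *ᵥ u = 1 / n * ∑ t, (∑ i, u i * residual S (x t) i) ^ 2 := by
      have : u ⬝ᵥ centeredCov x *ᵥ u = 1 / n * ∑ i, ∑ t, u i * (y t i * (y t ⬝ᵥ u)) := by
        rw [dotProduct, Finset.mul_sum]
        refine Finset.sum_congr rfl fun i _ => ?_
        rw [hmul, mul_left_comm, Finset.mul_sum]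
      rw [this, Finset.sum_comm]
      congr 1
      refine Finset.sum_congr rfl fun t _ => ?_
      rw [← hyu]
      have h2 : ∀ i, u i * (y t i * (y t ⬝ᵥ u)) = (y t i * u i) * (y t ⬝ᵥ u) := fun i => by ring
      simp only [h2, ← Finset.sum_mul]
      rw [pow_two]; rfl
    rw [e1]
    obtain ⟨k, hk⟩ := Function.ne_iff.1 hu
    calc 1 / n * ∑ t, (∑ i, u i * residual S (x t) i) ^ 2 ≤ 1 / n * (τ * ∑ i, u i ^ 2) :=
          mul_le_mul_of_nonneg_left (hR u) hn'.le
      _ = ∑ i, 1 / n * τ * u i ^ 2 := by rw [← mul_assoc, Finset.mul_sum]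
      _ < ∑ i, 1 / n * (∑ t, certEntry S i (x t)) * u i ^ 2 := by
          refine Finset.sum_lt_sum (fun i _ => ?_) ⟨k, Finset.mem_univ k, ?_⟩
          · have := (hD i).le
            gcongr
          · have : 0 < u k ^ 2 := by simpa using sq_pos_of_ne_zero hk
            have := hD k
            gcongr

/-! ### The Ising blockmodel: symmetries and finite energy -/

theorem spin_mul_self {p : ℕ} (σ : Config p) (i : Fin p) : spin σ i * spin σ i = 1 := by
  unfold spin
  rcases Int.units_eq_one_or (σ i) with h | h <;> simp [h]

theorem abs_spin {p : ℕ} (σ : Config p) (i : Fin p) : |spin σ i| = 1 := by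
  unfold spin
  rcases Int.units_eq_one_or (σ i) with h | h <;> simp [h]

theorem abs_blockVec {p : ℕ} (S : Finset (Fin p)) (i : Fin p) : |blockVec S i| = 1 := by
  unfold blockVec; split_ifs <;> norm_num

theorem blockVec_eq_or {p : ℕ} (S : Finset (Fin p)) (i : Fin p) :
    blockVec S i = 1 ∨ blockVec S i = -1 := by
  unfold blockVec; split_ifs <;> simp

theorem abs_magnetization_le {p : ℕ} (σ : Config p) : |magnetization σ| ≤ p := by
  refine (Finset.abs_sum_le_sum_abs _ _).trans ?_
  simp [abs_spin]

theorem abs_contrast_le {p : ℕ} (S : Finset (Fin p)) (σ : Config p) : |contrast S σ| ≤ p := by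
  refine (Finset.abs_sum_le_sum_abs _ _).trans ?_
  simp [abs_spin, abs_mul, abs_blockVec]

/-- In terms of the magnetization and of the block contrast the Hamiltonian is diagonal. -/
theorem exponent_eq {p : ℕ} (S : Finset (Fin p)) (α β : ℝ) (σ : Config p) :
    exponent S α β σ = (β + α) / (4 * p) * magnetization σ ^ 2 +
      (β - α) / (4 * p) * contrast S σ ^ 2 := by
  have hM : magnetization σ ^ 2 = ∑ i, ∑ j, spin σ i * spin σ j := by
    rw [pow_two, magnetization, Finset.sum_mul_sum]
  have hw : contrast S σ ^ 2 =
      ∑ i, ∑ j, blockVec S i * blockVec S j * (spin σ i * spin σ j) := by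
    rw [pow_two, contrast, Finset.sum_mul_sum]
    exact Finset.sum_congr rfl fun i _ => Finset.sum_congr rfl fun j _ => by ring
  have h1 : (∑ i, ∑ j, if (i ∈ S ↔ j ∈ S) then spin σ i * spin σ j else 0) =
      (magnetization σ ^ 2 + contrast S σ ^ 2) / 2 := by
    rw [hM, hw, ← Finset.sum_add_distrib, Finset.sum_div]
    refine Finset.sum_congr rfl fun i _ => ?_
    rw [← Finset.sum_add_distrib, Finset.sum_div]
    refine Finset.sum_congr rfl fun j _ => ?_
    unfold blockVec
    by_cases hi : i ∈ S <;> by_cases hj : j ∈ S <;> simp [hi, hj]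
  have h2 : (∑ i, ∑ j, if (i ∈ S ↔ j ∈ S) then 0 else spin σ i * spin σ j) =
      (magnetization σ ^ 2 - contrast S σ ^ 2) / 2 := by
    rw [hM, hw, ← Finset.sum_sub_distrib, Finset.sum_div]
    refine Finset.sum_congr rfl fun i _ => ?_
    rw [← Finset.sum_sub_distrib, Finset.sum_div]
    refine Finset.sum_congr rfl fun j _ => ?_
    unfold blockVec
    by_cases hi : i ∈ S <;> by_cases hj : j ∈ S <;> simp [hi, hj]
  rw [exponent, h1, h2]
  ring

theorem density_pos {p : ℕ} (S : Finset (Fin p)) (α β : ℝ) (σ : Config p) :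
    0 < density S α β σ := div_pos (Real.exp_pos _) (partitionFunction_pos S α β)

theorem sum_density {p : ℕ} (S : Finset (Fin p)) (α β : ℝ) : ∑ σ, density S α β σ = 1 := by
  simp only [density]
  rw [← Finset.sum_div, ← partitionFunction, div_self (partitionFunction_pos S α β).ne']

theorem density_eq_mul_exp {p : ℕ} (S : Finset (Fin p)) (α β : ℝ) (σ τ : Config p) :
    density S α β τ = density S α β σ * Real.exp (exponent S α β τ - exponent S α β σ) := by
  rw [density, density, div_mul_eq_mul_div, ← Real.exp_add]
  congr 2
  ring

/-- The expectation of `f` under the Ising blockmodel, as a finite sum. -/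
noncomputable def expect {p : ℕ} (S : Finset (Fin p)) (α β : ℝ) (f : Config p → ℝ) : ℝ :=
  ∑ σ, density S α β σ * f σ

section expect

variable {p : ℕ} {S : Finset (Fin p)} {α β : ℝ}

theorem expect_const (c : ℝ) : expect S α β (fun _ => c) = c := by
  rw [expect, ← Finset.sum_mul, sum_density, one_mul]

theorem expect_add (f g : Config p → ℝ) :
    expect S α β (fun σ => f σ + g σ) = expect S α β f + expect S α β g := by
  simp only [expect, mul_add, Finset.sum_add_distrib]

theorem expect_sub (f g : Config p → ℝ) :
    expect S α β (fun σ => f σ - g σ) = expect S α β f - expect S α β g := by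
  simp only [expect, mul_sub, Finset.sum_sub_distrib]

theorem expect_const_mul (c : ℝ) (f : Config p → ℝ) :
    expect S α β (fun σ => c * f σ) = c * expect S α β f := by
  simp only [expect, Finset.mul_sum]
  exact Finset.sum_congr rfl fun _ _ => by ring

theorem expect_sum {ι : Type*} (s : Finset ι) (f : ι → Config p → ℝ) :
    expect S α β (fun σ => ∑ i ∈ s, f i σ) = ∑ i ∈ s, expect S α β (f i) := by
  simp only [expect, Finset.mul_sum]
  exact Finset.sum_comm

theorem expect_mono {f g : Config p → ℝ} (h : ∀ σ, f σ ≤ g σ) :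
    expect S α β f ≤ expect S α β g :=
  Finset.sum_le_sum fun σ _ => mul_le_mul_of_nonneg_left (h σ) (density_pos S α β σ).le

theorem expect_nonneg {f : Config p → ℝ} (h : ∀ σ, 0 ≤ f σ) : 0 ≤ expect S α β f :=
  Finset.sum_nonneg fun σ _ => mul_nonneg (density_pos S α β σ).le (h σ)

theorem ibm_real_singleton (σ : Config p) : (ibm S α β).real {σ} = density S α β σ := by
  rw [Measure.real, ibm, withDensity_apply _ (measurableSet_singleton σ),
    Measure.restrict_singleton, Measure.count_singleton, one_smul, lintegral_dirac,
    ENNReal.toReal_ofReal (density_pos S α β σ).le]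

theorem integral_ibm (f : Config p → ℝ) : ∫ σ, f σ ∂(ibm S α β) = expect S α β f := by
  rw [integral_fintype .of_finite]
  simp only [ibm_real_singleton, smul_eq_mul, expect]

theorem sum_comp_perm (π : Equiv.Perm (Fin p)) (f : Config p → ℝ) :
    ∑ σ, f (σ ∘ π) = ∑ σ, f σ :=
  Equiv.sum_comp (Equiv.arrowCongr π.symm (Equiv.refl ℤˣ)) f

theorem magnetization_comp_perm (π : Equiv.Perm (Fin p)) (σ : Config p) :
    magnetization (σ ∘ π) = magnetization σ :=
  Equiv.sum_comp π (spin σ)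

/-- The permutation `π` maps each block onto a block: it preserves both blocks (`ε = 1`) or
exchanges them (`ε = -1`). -/
def RespectsBlocks (S : Finset (Fin p)) (π : Equiv.Perm (Fin p)) : Prop :=
  ∃ ε : ℝ, ε * ε = 1 ∧ ∀ i, blockVec S (π i) = ε * blockVec S i

theorem RespectsBlocks.mul {π ρ : Equiv.Perm (Fin p)} (hπ : RespectsBlocks S π)
    (hρ : RespectsBlocks S ρ) : RespectsBlocks S (π * ρ) := by
  obtain ⟨ε, hε, h⟩ := hπ
  obtain ⟨ε', hε', h'⟩ := hρ
  refine ⟨ε * ε', by linear_combination ε' * ε' * hε + hε', fun i => ?_⟩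
  rw [Equiv.Perm.mul_apply, h, h', mul_assoc]

theorem respectsBlocks_swap {i j : Fin p} (h : blockVec S i = blockVec S j) :
    RespectsBlocks S (Equiv.swap i j) := by
  refine ⟨1, by norm_num, fun k => ?_⟩
  rw [one_mul, Equiv.swap_apply_def]
  split_ifs with h1 h2
  · rw [h1, h]
  · rw [h2, h]
  · rfl

theorem contrast_comp_of_respectsBlocks {π : Equiv.Perm (Fin p)} (hπ : RespectsBlocks S π)
    (σ : Config p) : contrast S (σ ∘ π) ^ 2 = contrast S σ ^ 2 := by
  obtain ⟨ε, hε, h⟩ := hπ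
  have : contrast S σ = ε * contrast S (σ ∘ π) := by
    rw [contrast, ← Equiv.sum_comp π, contrast, Finset.mul_sum]
    refine Finset.sum_congr rfl fun i _ => ?_
    rw [h, mul_assoc]; rfl
  rw [this]
  linear_combination -(contrast S (σ ∘ π) ^ 2) * hε

theorem density_comp_of_respectsBlocks {π : Equiv.Perm (Fin p)} (hπ : RespectsBlocks S π)
    (σ : Config p) : density S α β (σ ∘ π) = density S α β σ := by
  rw [density, density, exponent_eq, exponent_eq, magnetization_comp_perm,
    contrast_comp_of_respectsBlocks hπ]

theorem expect_comp_of_respectsBlocks {π : Equiv.Perm (Fin p)} (hπ : RespectsBlocks S π)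
    (f : Config p → ℝ) : expect S α β (fun σ => f (σ ∘ π)) = expect S α β f := by
  rw [expect, expect, ← sum_comp_perm π (fun σ => density S α β σ * f σ)]
  simp only [density_comp_of_respectsBlocks hπ]

end expect

theorem exists_respectsBlocks_exchange {p : ℕ} {S : Finset (Fin p)} (hS : 2 * S.card = p) :
    ∃ π : Equiv.Perm (Fin p), RespectsBlocks S π ∧ ∀ i, blockVec S (π i) = -blockVec S i := by
  have hc : Fintype.card {i // i ∈ S} = Fintype.card {i // i ∉ S} := by
    rw [Fintype.card_subtype_compl, Fintype.card_coe, Fintype.card_fin]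
    omega
  let e := Fintype.equivOfCardEq hc
  have h : ∀ i, blockVec S (e.extendSubtype i) = -blockVec S i := by
    intro i
    by_cases hi : i ∈ S
    · have := e.extendSubtype_mem i hi
      simp [blockVec, hi, this]
    · have := e.extendSubtype_not_mem i hi
      simp only [not_not] at this
      simp [blockVec, hi, this]
  exact ⟨e.extendSubtype, ⟨-1, by norm_num, fun i => by rw [h]; ring⟩, h⟩

/-- Exchangeability: the correlation of two distinct spins depends only on whether they lie in the
same block. -/
theorem expect_spin_mul_spin_eq {p : ℕ} {S : Finset (Fin p)} (hS : 2 * S.card = p) (α β : ℝ)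
    {i j k l : Fin p} (hij : i ≠ j) (hkl : k ≠ l)
    (h : blockVec S i * blockVec S j = blockVec S k * blockVec S l) :
    expect S α β (fun σ => spin σ i * spin σ j) = expect S α β (fun σ => spin σ k * spin σ l) := by
  obtain ⟨π, hπ, hik, hjl⟩ : ∃ π, RespectsBlocks S π ∧ blockVec S (π i) = blockVec S k ∧
      blockVec S (π j) = blockVec S l := by
    have hi := blockVec_mul_self S i
    have hor : blockVec S i = blockVec S k ∨ blockVec S i = -blockVec S k := by
      rcases blockVec_eq_or S i with hi | hi <;> rcases blockVec_eq_or S k with hk | hk <;>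
        simp [hi, hk]
    rcases hor with hik | hik
    · refine ⟨1, ⟨1, by norm_num, fun i => by simp⟩, by simpa using hik, ?_⟩
      rw [Equiv.Perm.one_apply]
      linear_combination (blockVec S l - blockVec S j) * hi + blockVec S i * h -
        blockVec S i * blockVec S l * hik
    · obtain ⟨π, hπ, hneg⟩ := exists_respectsBlocks_exchange hS
      refine ⟨π, hπ, by rw [hneg, hik, neg_neg], ?_⟩
      rw [hneg]
      linear_combination (blockVec S j + blockVec S l) * hi - blockVec S i * h -
        blockVec S i * blockVec S l * hik
  set j' := Equiv.swap (π i) k (π j)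
  have hj' : blockVec S j' = blockVec S l := by
    obtain ⟨ε, hε, he⟩ := respectsBlocks_swap hik
    have h1 := he (π i)
    rw [Equiv.swap_apply_left, ← hik] at h1
    have h2 : ε = 1 := by
      have := blockVec_mul_self S (π i)
      linear_combination -(ε - 1) * this - blockVec S (π i) * h1
    rw [he, h2, one_mul, hjl]
  have hkj' : k ≠ j' := by
    rw [← Equiv.swap_apply_left (π i) k]
    exact fun hh => hij (π.injective ((Equiv.swap (π i) k).injective hh))
  have key : RespectsBlocks S (Equiv.swap j' l * (Equiv.swap (π i) k * π)) :=
    (respectsBlocks_swap hj').mul ((respectsBlocks_swap hik).mul hπ)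
  rw [← expect_comp_of_respectsBlocks key]
  have e1 : (Equiv.swap j' l * (Equiv.swap (π i) k * π)) i = k := by
    simp only [Equiv.Perm.mul_apply, Equiv.swap_apply_left]
    exact Equiv.swap_apply_of_ne_of_ne hkj' hkl
  have e2 : (Equiv.swap j' l * (Equiv.swap (π i) k * π)) j = l := by
    simp only [Equiv.Perm.mul_apply]
    exact Equiv.swap_apply_left _ _
  have e3 : ∀ σ : Config p, ∀ a,
      spin (σ ∘ (Equiv.swap j' l * (Equiv.swap (π i) k * π))) a =
        spin σ ((Equiv.swap j' l * (Equiv.swap (π i) k * π)) a) := fun _ _ => rfl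
  simp only [e3, e1, e2]

theorem spin_update {p : ℕ} (σ : Config p) (i j : Fin p) (u : ℤˣ) :
    spin (Function.update σ i u) j = if j = i then ((u : ℤ) : ℝ) else spin σ j := by
  unfold spin
  rw [Function.update_apply]
  split_ifs <;> rfl

theorem sum_mul_spin_flip {p : ℕ} (a : Fin p → ℝ) (σ : Config p) (i : Fin p) :
    ∑ j, a j * spin (Function.update σ i (-σ i)) j =
      (∑ j, a j * spin σ j) - 2 * a i * spin σ i := by
  rw [← Finset.add_sum_erase _ _ (Finset.mem_univ i),
    ← Finset.add_sum_erase (a := i) _ (fun j => a j * spin σ j) (Finset.mem_univ i)]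
  have : ∑ j ∈ Finset.univ.erase i, a j * spin (Function.update σ i (-σ i)) j =
      ∑ j ∈ Finset.univ.erase i, a j * spin σ j := by
    refine Finset.sum_congr rfl fun j hj => ?_
    rw [spin_update, if_neg (Finset.ne_of_mem_erase hj)]
  rw [this, spin_update, if_pos rfl]
  simp only [Units.val_neg, Int.cast_neg]
  unfold spin
  ring

/-- Finite energy: flipping one spin changes the exponent by a bounded amount. -/
theorem exponent_flip_le {p : ℕ} (hp : 0 < p) (S : Finset (Fin p)) (α β : ℝ) (σ : Config p)
    (i : Fin p) :
    exponent S α β (Function.update σ i (-σ i)) ≤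
      exponent S α β σ + (|β + α| + |β - α|) := by
  have key : ∀ x s b : ℝ, |x| ≤ p → |x - 2 * s| ≤ p → |s| = 1 →
      b / (4 * p) * (x - 2 * s) ^ 2 ≤ b / (4 * p) * x ^ 2 + |b| := by
    intro x s b hx hxs hs
    have h1 : |(x - 2 * s) ^ 2 - x ^ 2| ≤ 4 * (p : ℝ) := by
      have : (x - 2 * s) ^ 2 - x ^ 2 = (-2 * s) * (x + (x - 2 * s)) := by ring
      rw [this, abs_mul, abs_mul, hs]
      have := abs_add_le x (x - 2 * s)
      norm_num
      linarith
    have h2 : b / (4 * p) * ((x - 2 * s) ^ 2 - x ^ 2) ≤ |b| := by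
      refine (le_abs_self _).trans ?_
      rw [abs_mul, abs_div, abs_of_pos (by positivity : (0 : ℝ) < 4 * p), div_mul_eq_mul_div,
        div_le_iff₀ (by positivity)]
      exact mul_le_mul_of_nonneg_left h1 (abs_nonneg b)
    linarith
  have hM : magnetization (Function.update σ i (-σ i)) = magnetization σ - 2 * spin σ i := by
    simpa [magnetization] using sum_mul_spin_flip (fun _ => 1) σ i
  have hw : contrast S (Function.update σ i (-σ i)) =
      contrast S σ - 2 * (blockVec S i * spin σ i) := by
    simpa [contrast, mul_assoc] using sum_mul_spin_flip (blockVec S) σ i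
  have h1 := abs_magnetization_le (Function.update σ i (-σ i))
  have h2 := abs_contrast_le S (Function.update σ i (-σ i))
  rw [hM] at h1
  rw [hw] at h2
  have k1 := key _ _ (β + α) (abs_magnetization_le σ) h1 (abs_spin σ i)
  have k2 := key _ _ (β - α) (abs_contrast_le S σ) h2
    (by rw [abs_mul, abs_blockVec, abs_spin, one_mul])
  rw [exponent_eq, exponent_eq, hM, hw]
  linarith

/-- The indicator of the event `σ_i = u`. -/
noncomputable def spinIndicator {p : ℕ} (i : Fin p) (u : ℤˣ) (σ : Config p) : ℝ :=
  if σ i = u then 1 else 0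

/-- The constant `1 + K`, where `K` bounds the ratio of the probabilities of two configurations that
differ at one site. -/
noncomputable def energyConst (α β : ℝ) : ℝ := 1 + Real.exp (|β + α| + |β - α|)

theorem one_le_energyConst (α β : ℝ) : 1 ≤ energyConst α β := by
  unfold energyConst; linarith [Real.exp_pos (|β + α| + |β - α|)]

/-- Prescribing the spin at a site on which `g` does not depend costs at most a constant factor. -/
theorem expect_le_expect_indicator {p : ℕ} (S : Finset (Fin p)) (α β : ℝ) {g : Config p → ℝ}
    (hg : ∀ σ, 0 ≤ g σ) (i : Fin p) (hi : ∀ σ u, g (Function.update σ i u) = g σ) (u : ℤˣ) :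
    expect S α β g ≤ energyConst α β * expect S α β (fun σ => spinIndicator i u σ * g σ) := by
  have hp : 0 < p := i.pos
  let flip : Config p → Config p := fun σ => Function.update σ i (-σ i)
  have hflip : Function.Involutive flip := by
    intro σ
    simp [flip]
  have h1 : expect S α β g = expect S α β (fun σ => spinIndicator i u σ * g σ) +
      expect S α β (fun σ => (1 - spinIndicator i u σ) * g σ) := by
    rw [← expect_add]
    congr 1
    ext σ
    ring
  have h2 : expect S α β (fun σ => (1 - spinIndicator i u σ) * g σ) ≤
      Real.exp (|β + α| + |β - α|) * expect S α β (fun σ => spinIndicator i u σ * g σ) := by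
    rw [← expect_const_mul, expect, expect, ← Equiv.sum_comp hflip.toPerm]
    refine Finset.sum_le_sum fun σ _ => ?_
    have e1 : g (flip σ) = g σ := hi _ _
    have e2 : 1 - spinIndicator i u (flip σ) = spinIndicator i u σ := by
      simp only [spinIndicator, flip, Function.update_self]
      rcases Int.units_eq_one_or (σ i) with h | h <;> rcases Int.units_eq_one_or u with h' | h' <;>
        simp [h, h']
    have e3 : density S α β (flip σ) ≤ density S α β σ * Real.exp (|β + α| + |β - α|) := by
      rw [density_eq_mul_exp S α β σ (flip σ)]
      refine mul_le_mul_of_nonneg_left (Real.exp_le_exp.2 ?_) (density_pos S α β σ).le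
      linarith [exponent_flip_le hp S α β σ i]
    change density S α β (flip σ) * ((1 - spinIndicator i u (flip σ)) * g (flip σ)) ≤ _
    rw [e1, e2]
    have e4 : 0 ≤ spinIndicator i u σ * g σ := by
      refine mul_nonneg ?_ (hg σ)
      unfold spinIndicator; split_ifs <;> norm_num
    calc _ ≤ density S α β σ * Real.exp (|β + α| + |β - α|) * (spinIndicator i u σ * g σ) :=
          mul_le_mul_of_nonneg_right e3 e4
      _ = _ := by ring
  rw [h1, energyConst]
  linarith

theorem spinIndicator_nonneg {p : ℕ} (i : Fin p) (u : ℤˣ) (σ : Config p) :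
    0 ≤ spinIndicator i u σ := by
  unfold spinIndicator; split_ifs <;> norm_num

theorem spinIndicator_update {p : ℕ} {i j : Fin p} (h : i ≠ j) (u u' : ℤˣ) (σ : Config p) :
    spinIndicator i u (Function.update σ j u') = spinIndicator i u σ := by
  unfold spinIndicator; rw [Function.update_of_ne h]

/-! ### The covariance gap -/

/-- Two sites take prescribed values with probability bounded below. -/
theorem expect_two_spinIndicator_ge {p : ℕ} (S : Finset (Fin p)) (α β : ℝ) {i j : Fin p}
    (hij : i ≠ j) (u v : ℤˣ) :
    1 ≤ energyConst α β ^ 2 *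
      expect S α β (fun σ => spinIndicator j v σ * (spinIndicator i u σ * 1)) := by
  have hE : 0 ≤ energyConst α β := zero_le_one.trans (one_le_energyConst α β)
  have h1 := expect_le_expect_indicator S α β (g := fun _ => 1) (fun _ => zero_le_one) i
    (fun _ _ => rfl) u
  have h2 := expect_le_expect_indicator S α β (g := fun σ => spinIndicator i u σ * 1)
    (fun σ => mul_nonneg (spinIndicator_nonneg i u σ) zero_le_one) j
    (fun σ u' => by rw [spinIndicator_update hij]) v
  rw [expect_const] at h1
  refine h1.trans ?_
  rw [pow_two, mul_assoc]
  exact mul_le_mul_of_nonneg_left h2 hE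

/-- Four sites take prescribed values with probability bounded below. -/
theorem expect_four_spinIndicator_ge {p : ℕ} (S : Finset (Fin p)) (α β : ℝ) {i j k l : Fin p}
    (hij : i ≠ j) (hik : i ≠ k) (hil : i ≠ l) (hjk : j ≠ k) (hjl : j ≠ l) (hkl : k ≠ l)
    (u v u' v' : ℤˣ) :
    1 ≤ energyConst α β ^ 4 * expect S α β (fun σ => spinIndicator l v' σ *
      (spinIndicator k u' σ * (spinIndicator j v σ * (spinIndicator i u σ * 1)))) := by
  have hE : 0 ≤ energyConst α β := zero_le_one.trans (one_le_energyConst α β)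
  have hnn : ∀ σ : Config p, 0 ≤ spinIndicator j v σ * (spinIndicator i u σ * 1) := fun σ =>
    mul_nonneg (spinIndicator_nonneg j v σ) (mul_nonneg (spinIndicator_nonneg i u σ) zero_le_one)
  have h1 := expect_two_spinIndicator_ge S α β hij u v
  have h2 := expect_le_expect_indicator S α β hnn k
    (fun σ w => by rw [spinIndicator_update hik, spinIndicator_update hjk]) u'
  have h3 := expect_le_expect_indicator S α β
    (fun σ => mul_nonneg (spinIndicator_nonneg k u' σ) (hnn σ)) l
    (fun σ w => by
      rw [spinIndicator_update hil, spinIndicator_update hjl, spinIndicator_update hkl]) v'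
  refine h1.trans ?_
  rw [show energyConst α β ^ 4 = energyConst α β ^ 2 * (energyConst α β * energyConst α β) by ring,
    mul_assoc]
  refine mul_le_mul_of_nonneg_left (h2.trans ?_) (by positivity)
  rw [mul_assoc]
  exact mul_le_mul_of_nonneg_left h3 hE

theorem contrast_comp_swap {p : ℕ} (S : Finset (Fin p)) (σ : Config p) {i j : Fin p} (hij : i ≠ j) :
    contrast S (σ ∘ Equiv.swap i j) =
      contrast S σ + (blockVec S i - blockVec S j) * (spin σ j - spin σ i) := by
  have h : ∑ x, blockVec S x * (spin (σ ∘ Equiv.swap i j) x - spin σ x) =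
      blockVec S i * (spin (σ ∘ Equiv.swap i j) i - spin σ i) +
        blockVec S j * (spin (σ ∘ Equiv.swap i j) j - spin σ j) := by
    refine Fintype.sum_eq_add i j hij fun x hx => ?_
    have : spin (σ ∘ Equiv.swap i j) x = spin σ x := by
      unfold spin
      rw [Function.comp_apply, Equiv.swap_apply_of_ne_of_ne hx.1 hx.2]
    rw [this, sub_self, mul_zero]
  have e1 : spin (σ ∘ Equiv.swap i j) i = spin σ j := by
    unfold spin; rw [Function.comp_apply, Equiv.swap_apply_left]
  have e2 : spin (σ ∘ Equiv.swap i j) j = spin σ i := by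
    unfold spin; rw [Function.comp_apply, Equiv.swap_apply_right]
  rw [e1, e2] at h
  simp only [mul_sub, Finset.sum_sub_distrib] at h
  simp only [contrast]
  linear_combination h

/-- First-order lower bound for the density after a shift of the contrast, from `1 + x ≤ exp x`. -/
theorem density_of_contrast_shift {p : ℕ} (S : Finset (Fin p)) (α β : ℝ) {σ τ : Config p} {c : ℝ}
    (hM : magnetization τ = magnetization σ) (hw : contrast S τ = contrast S σ + c) :
    density S α β σ * (1 + (β - α) / (4 * p) * (2 * c * contrast S σ + c ^ 2)) ≤
      density S α β τ := by
  rw [density_eq_mul_exp S α β σ τ]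
  refine mul_le_mul_of_nonneg_left ?_ (density_pos S α β σ).le
  rw [exponent_eq, exponent_eq, hM, hw]
  have := Real.add_one_le_exp ((β + α) / (4 * p) * magnetization σ ^ 2 +
    (β - α) / (4 * p) * (contrast S σ + c) ^ 2 - ((β + α) / (4 * p) * magnetization σ ^ 2 +
    (β - α) / (4 * p) * contrast S σ ^ 2))
  linarith

/-- Two disjoint pairs `(i, k)`, `(j, l)`, each with one site in either block, are positively
correlated, quantitatively: exchanging the two spins of a pair leaves the magnetization unchanged
and moves the contrast by `± 4`, and the weight `exp (c w²)` is convex in the contrast `w`. -/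
theorem expect_mul_pair_differences_ge {p : ℕ} (hp : 0 < p) {S : Finset (Fin p)} {α β : ℝ}
    (hαβ : α < β) {i j k l : Fin p} (hij : i ≠ j) (hik : i ≠ k) (hil : i ≠ l) (hjk : j ≠ k)
    (hjl : j ≠ l) (hkl : k ≠ l) (hi : blockVec S i = blockVec S j)
    (hk : blockVec S k = -blockVec S i) (hl : blockVec S l = -blockVec S i) :
    32 * (β - α) / (p * energyConst α β ^ 4) ≤
      expect S α β (fun σ => (spin σ i - spin σ k) * (spin σ j - spin σ l)) := by
  set B : Config p → ℝ := fun σ => spinIndicator l 1 σ *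
      (spinIndicator k (-1) σ * (spinIndicator j (-1) σ * (spinIndicator i 1 σ * 1))) with hB
  have hB0 : ∀ σ, 0 ≤ B σ := fun σ => mul_nonneg (spinIndicator_nonneg _ _ _)
    (mul_nonneg (spinIndicator_nonneg _ _ _) (mul_nonneg (spinIndicator_nonneg _ _ _)
    (mul_nonneg (spinIndicator_nonneg _ _ _) zero_le_one)))
  have hprob : 1 ≤ energyConst α β ^ 4 * expect S α β B :=
    expect_four_spinIndicator_ge S α β hij hik hil hjk hjl hkl 1 (-1) (-1) 1
  -- `B` is the indicator of an event on which the product of the differences is `-4`; exchanging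
  -- the spins of one pair or of both maps this event onto the three others where it is nonzero.
  have hpt : ∀ σ : Config p, (spin σ i - spin σ k) * (spin σ j - spin σ l) =
      4 * (B (σ ∘ Equiv.swap i k) + B (σ ∘ Equiv.swap j l) - B σ -
        B ((σ ∘ Equiv.swap i k) ∘ Equiv.swap j l)) := by
    intro σ
    simp only [hB, spinIndicator, Function.comp_apply, spin, Equiv.swap_apply_left,
      Equiv.swap_apply_right, Equiv.swap_apply_of_ne_of_ne hij hil,
      Equiv.swap_apply_of_ne_of_ne hij.symm hjk, Equiv.swap_apply_of_ne_of_ne hjk.symm hkl,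
      Equiv.swap_apply_of_ne_of_ne hil.symm hkl.symm]
    rcases Int.units_eq_one_or (σ i) with h1 | h1 <;>
    rcases Int.units_eq_one_or (σ j) with h2 | h2 <;>
    rcases Int.units_eq_one_or (σ k) with h3 | h3 <;>
    rcases Int.units_eq_one_or (σ l) with h4 | h4 <;>
    simp [h1, h2, h3, h4] <;> norm_num
  have hinv : ∀ (π : Equiv.Perm (Fin p)), π * π = 1 → ∀ f : Config p → ℝ,
      ∑ σ, density S α β σ * f (σ ∘ π) = ∑ σ, density S α β (σ ∘ π) * f σ := by
    intro π hπ f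
    rw [← sum_comp_perm π]
    refine Finset.sum_congr rfl fun σ _ => ?_
    have : (σ ∘ π) ∘ π = σ := by
      ext x
      have := congrArg (fun ρ : Equiv.Perm (Fin p) => σ (ρ x)) hπ
      exact congrArg _ this
    rw [this]
  have e3 : ∑ σ, density S α β σ * B ((σ ∘ Equiv.swap i k) ∘ Equiv.swap j l) =
      ∑ σ, density S α β ((σ ∘ Equiv.swap i k) ∘ Equiv.swap j l) * B σ := by
    rw [hinv (Equiv.swap i k) (Equiv.swap_mul_self i k) (fun σ => B (σ ∘ Equiv.swap j l))]
    rw [← sum_comp_perm (Equiv.swap j l)]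
    refine Finset.sum_congr rfl fun σ _ => ?_
    have e1 : (σ ∘ Equiv.swap j l) ∘ Equiv.swap j l = σ := by
      ext x; simp
    have e2 : (σ ∘ Equiv.swap j l) ∘ Equiv.swap i k = (σ ∘ Equiv.swap i k) ∘ Equiv.swap j l := by
      have hc : Equiv.swap j l * Equiv.swap i k = Equiv.swap i k * Equiv.swap j l :=
        (Equiv.Perm.disjoint_swap_swap (by simp [*, Ne.symm, hij.symm, hil.symm, hkl.symm])).commute
      ext x
      have := congrArg (fun ρ : Equiv.Perm (Fin p) => σ (ρ x)) hc
      exact congrArg _ this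
    rw [e1, e2]
  have hexp : expect S α β (fun σ => (spin σ i - spin σ k) * (spin σ j - spin σ l)) =
      4 * ∑ σ, (density S α β (σ ∘ Equiv.swap i k) + density S α β (σ ∘ Equiv.swap j l) -
        density S α β σ - density S α β ((σ ∘ Equiv.swap i k) ∘ Equiv.swap j l)) * B σ := by
    simp only [hpt, expect_const_mul]
    congr 1
    rw [expect_sub, expect_sub, expect_add]
    simp only [expect, sub_mul, add_mul, Finset.sum_sub_distrib, Finset.sum_add_distrib]
    rw [e3, hinv (Equiv.swap i k) (Equiv.swap_mul_self i k),
      hinv (Equiv.swap j l) (Equiv.swap_mul_self j l)]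
  have hterm : ∀ σ, density S α β σ * (8 * (β - α) / p) * B σ ≤
      (density S α β (σ ∘ Equiv.swap i k) + density S α β (σ ∘ Equiv.swap j l) -
        density S α β σ - density S α β ((σ ∘ Equiv.swap i k) ∘ Equiv.swap j l)) * B σ := by
    intro σ
    by_cases hσ : σ i = 1 ∧ σ j = -1 ∧ σ k = -1 ∧ σ l = 1
    swap
    · have : B σ = 0 := by
        simp only [hB, spinIndicator]
        by_contra h
        apply hσ
        refine ⟨?_, ?_, ?_, ?_⟩ <;> · by_contra h'; simp [h'] at h
      rw [this, mul_zero, mul_zero]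
    obtain ⟨h1, h2, h3, h4⟩ := hσ
    have s1 : spin σ i = 1 := by simp [spin, h1]
    have s2 : spin σ j = -1 := by simp [spin, h2]
    have s3 : spin σ k = -1 := by simp [spin, h3]
    have s4 : spin σ l = 1 := by simp [spin, h4]
    have w1 : contrast S (σ ∘ Equiv.swap i k) = contrast S σ + -(4 * blockVec S i) := by
      rw [contrast_comp_swap S σ hik, s1, s3, hk]; ring
    have w2 : contrast S (σ ∘ Equiv.swap j l) = contrast S σ + 4 * blockVec S i := by
      rw [contrast_comp_swap S σ hjl, s2, s4, hl, ← hi]; ring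
    have w3 : contrast S ((σ ∘ Equiv.swap i k) ∘ Equiv.swap j l) = contrast S σ := by
      rw [contrast_comp_swap S _ hjl, w1, hl, ← hi]
      have t1 : spin (σ ∘ Equiv.swap i k) l = spin σ l := by
        unfold spin
        rw [Function.comp_apply, Equiv.swap_apply_of_ne_of_ne hil.symm hkl.symm]
      have t2 : spin (σ ∘ Equiv.swap i k) j = spin σ j := by
        unfold spin
        rw [Function.comp_apply, Equiv.swap_apply_of_ne_of_ne hij.symm hjk]
      rw [t1, t2, s2, s4]; ring
    have d1 := density_of_contrast_shift S α β (magnetization_comp_perm (Equiv.swap i k) σ) w1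
    have d2 := density_of_contrast_shift S α β (magnetization_comp_perm (Equiv.swap j l) σ) w2
    have d3 : density S α β ((σ ∘ Equiv.swap i k) ∘ Equiv.swap j l) = density S α β σ := by
      rw [density, density, exponent_eq, exponent_eq, w3, magnetization_comp_perm,
        magnetization_comp_perm]
    refine mul_le_mul_of_nonneg_right ?_ (hB0 σ)
    rw [d3]
    have hv := blockVec_mul_self S i
    have hid : density S α β σ * (8 * (β - α) / p) =
        density S α β σ * (1 + (β - α) / (4 * p) *
          (2 * (-(4 * blockVec S i)) * contrast S σ + (-(4 * blockVec S i)) ^ 2)) +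
        density S α β σ * (1 + (β - α) / (4 * p) *
          (2 * (4 * blockVec S i) * contrast S σ + (4 * blockVec S i) ^ 2)) -
        density S α β σ - density S α β σ := by
      linear_combination -(density S α β σ * (8 * (β - α) / p)) * hv
    linarith
  rw [hexp]
  have hsum := Finset.sum_le_sum fun σ (_ : σ ∈ Finset.univ) => hterm σ
  have hl' : ∑ σ, density S α β σ * (8 * (β - α) / p) * B σ =
      8 * (β - α) / p * expect S α β B := by
    rw [expect, Finset.mul_sum]
    exact Finset.sum_congr rfl fun σ _ => by ring
  rw [hl'] at hsum
  have hE : 0 < energyConst α β ^ 4 := pow_pos (zero_lt_one.trans_le (one_le_energyConst α β)) 4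
  have hb : 0 < β - α := sub_pos.2 hαβ
  have hp' : (0 : ℝ) < p := by positivity
  have hlow : 1 / energyConst α β ^ 4 ≤ expect S α β B := by
    rw [div_le_iff₀ hE]; linarith
  have : 8 * (β - α) / p * (1 / energyConst α β ^ 4) ≤ 8 * (β - α) / p * expect S α β B :=
    mul_le_mul_of_nonneg_left hlow (by positivity)
  calc 32 * (β - α) / (p * energyConst α β ^ 4)
      = 4 * (8 * (β - α) / p * (1 / energyConst α β ^ 4)) := by field_simp; ring
    _ ≤ _ := by linarith

/-- A lower bound for `p (Δ - Ω) / 2`, where `Δ` and `Ω` are the correlations of two spins in the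
same block and in different blocks. -/
noncomputable def gapConst (α β : ℝ) : ℝ := min (8 * (β - α)) 2 / energyConst α β ^ 4

theorem gapConst_pos {α β : ℝ} (hαβ : α < β) : 0 < gapConst α β := by
  have hE : 0 < energyConst α β ^ 4 := pow_pos (zero_lt_one.trans_le (one_le_energyConst α β)) 4
  have hb : 0 < β - α := sub_pos.2 hαβ
  unfold gapConst
  positivity

/-- The population covariance is `s I + η 𝟏𝟏ᵀ + g v vᵀ`, where `v = v_S`. If `Δ` and `Ω` are the
correlations of two spins in the same block and in different blocks, then `s = 1 - Δ`,
`η = (Δ + Ω) / 2` and `g = (Δ - Ω) / 2`; for `p = 2` the value of `Δ` is a free choice. -/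
structure IsCovariance {p : ℕ} (S : Finset (Fin p)) (α β s η g : ℝ) : Prop where
  nonneg : 0 ≤ s
  le_two : s ≤ 2
  expect_eq : ∀ i j, expect S α β (fun σ => spin σ i * spin σ j) =
    (if i = j then s else 0) + η + g * (blockVec S i * blockVec S j)

theorem expect_abs_le_one {p : ℕ} (S : Finset (Fin p)) (α β : ℝ) (i j : Fin p) :
    |expect S α β (fun σ => spin σ i * spin σ j)| ≤ 1 := by
  have h : ∀ σ : Config p, |spin σ i * spin σ j| = 1 := fun σ => by
    rw [abs_mul, abs_spin, abs_spin, one_mul]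
  rw [abs_le]
  constructor
  · rw [← expect_const (S := S) (α := α) (β := β) (-1)]
    exact expect_mono fun σ => (abs_le.1 (h σ).le).1
  · rw [← expect_const (S := S) (α := α) (β := β) 1]
    exact expect_mono fun σ => (abs_le.1 (h σ).le).2

/-- The covariance has the block form, and its gap `p g` is bounded below uniformly in `p`. -/
theorem exists_isCovariance {p : ℕ} (hp : 0 < p) {S : Finset (Fin p)} (hS : 2 * S.card = p)
    {α β : ℝ} (hαβ : α < β) :
    ∃ s η g, IsCovariance S α β s η g ∧ gapConst α β ≤ p * g := by
  have hE1 := one_le_energyConst α β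
  have hE : 0 < energyConst α β ^ 4 := pow_pos (zero_lt_one.trans_le hE1) 4
  have hp' : (0 : ℝ) < p := by positivity
  obtain ⟨τ, hτ, hneg⟩ := exists_respectsBlocks_exchange hS
  have hsub : ∀ i j, blockVec S i * blockVec S j = 1 ∨ blockVec S i * blockVec S j = -1 := by
    intro i j
    rcases blockVec_eq_or S i with hi | hi <;> rcases blockVec_eq_or S j with hj | hj <;>
      simp [hi, hj]
  set i₀ : Fin p := ⟨0, hp⟩
  set k₀ := τ i₀
  have hcross : blockVec S i₀ * blockVec S k₀ = -1 := by
    rw [hneg, mul_neg, blockVec_mul_self]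
  have hik₀ : i₀ ≠ k₀ := by
    intro h
    rw [← h, blockVec_mul_self] at hcross
    norm_num at hcross
  set Ω := expect S α β (fun σ => spin σ i₀ * spin σ k₀)
  have hdiag : ∀ i, expect S α β (fun σ => spin σ i * spin σ i) = 1 := by
    intro i
    simp only [spin_mul_self, expect_const]
  have build : ∀ Δ : ℝ, |Δ| ≤ 1 → (∀ i j, i ≠ j → blockVec S i * blockVec S j = 1 →
      expect S α β (fun σ => spin σ i * spin σ j) = Δ) →
      IsCovariance S α β (1 - Δ) ((Δ + Ω) / 2) ((Δ - Ω) / 2) := by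
    intro Δ hΔ h
    have := abs_le.1 hΔ
    refine ⟨by linarith, by linarith, fun i j => ?_⟩
    by_cases hij : i = j
    · rw [if_pos hij, hij, hdiag, blockVec_mul_self]; ring
    · rw [if_neg hij]
      rcases hsub i j with h1 | h1
      · rw [h i j hij h1, h1]; ring
      · rw [expect_spin_mul_spin_eq hS α β hij hik₀ (h1.trans hcross.symm), h1]
        change Ω = _
        ring
  by_cases hex : ∃ i j, i ≠ j ∧ blockVec S i * blockVec S j = 1
  · obtain ⟨i, j, hij, h1⟩ := hex
    set Δ := expect S α β (fun σ => spin σ i * spin σ j)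
    have hΔ := build Δ (expect_abs_le_one S α β i j) fun k l hkl h =>
      expect_spin_mul_spin_eq hS α β hkl hij (h.trans h1.symm)
    refine ⟨_, _, _, hΔ, ?_⟩
    have hvi := blockVec_mul_self S i
    have hvij : blockVec S i = blockVec S j := by
      linear_combination blockVec S j * hvi - blockVec S i * h1
    have hne : ∀ a b, blockVec S a = blockVec S i → blockVec S b = -blockVec S i → a ≠ b := by
      rintro a b ha hb rfl
      rw [ha] at hb
      have : blockVec S i = 0 := by linarith
      rw [this] at hvi
      norm_num at hvi
    have hgap := expect_mul_pair_differences_ge hp (S := S) hαβ (i := i) (j := j) (k := τ i)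
      (l := τ j) hij (hne _ _ rfl (hneg i)) (hne _ _ rfl (by rw [hneg, hvij]))
      (hne _ _ hvij.symm (hneg i)) (hne _ _ hvij.symm (by rw [hneg, hvij]))
      (fun h => hij (τ.injective h)) hvij (hneg i) (by rw [hneg, hvij])
    have heq : expect S α β (fun σ => (spin σ i - spin σ (τ i)) * (spin σ j - spin σ (τ j))) =
        2 * (Δ - Ω) := by
      have e : ∀ σ : Config p, (spin σ i - spin σ (τ i)) * (spin σ j - spin σ (τ j)) =
          spin σ i * spin σ j - spin σ i * spin σ (τ j) -
            (spin σ (τ i) * spin σ j - spin σ (τ i) * spin σ (τ j)) := fun σ => by ring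
      simp only [e]
      rw [expect_sub, expect_sub, expect_sub]
      simp only [hΔ.expect_eq]
      rw [if_neg hij, if_neg (hne _ _ rfl (by rw [hneg, hvij])),
        if_neg (hne _ _ hvij.symm (hneg i)).symm, if_neg (fun h => hij (τ.injective h)), hneg, hneg,
        ← hvij]
      linear_combination (2 * (Δ - Ω)) * hvi
    rw [heq] at hgap
    rw [gapConst]
    have h2 : 32 * (β - α) / (p * energyConst α β ^ 4) =
        4 / p * (8 * (β - α) / energyConst α β ^ 4) := by field_simp; ring
    rw [h2, div_mul_eq_mul_div, div_le_iff₀ hp'] at hgap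
    have h3 : min (8 * (β - α)) 2 / energyConst α β ^ 4 ≤ 8 * (β - α) / energyConst α β ^ 4 := by
      gcongr; exact min_le_left _ _
    linarith
  · -- Both blocks are singletons; the value `Δ = 1` makes the identity part vanish.
    refine ⟨_, _, _, build 1 (by norm_num) fun i j hij h => absurd ⟨i, j, hij, h⟩ hex, ?_⟩
    have hp2 : (2 : ℝ) ≤ p := by
      have : S.card ≠ 0 := by intro h; omega
      exact_mod_cast (by omega : 2 ≤ p)
    have hΩ : 1 - Ω = expect S α β (fun σ => 1 - spin σ i₀ * spin σ k₀) := by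
      rw [expect_sub, expect_const]
    have h1 := expect_two_spinIndicator_ge S α β hik₀ 1 (-1)
    have h2 : 2 * expect S α β (fun σ => spinIndicator k₀ (-1) σ * (spinIndicator i₀ 1 σ * 1)) ≤
        1 - Ω := by
      rw [hΩ, ← expect_const_mul]
      refine expect_mono fun σ => ?_
      unfold spinIndicator spin
      rcases Int.units_eq_one_or (σ i₀) with h | h <;>
        rcases Int.units_eq_one_or (σ k₀) with h' | h' <;> (simp [h, h']; try norm_num)
    have h4 : gapConst α β ≤ 2 / energyConst α β ^ 2 := by
      rw [gapConst]
      have : energyConst α β ^ 2 ≤ energyConst α β ^ 4 := pow_le_pow_right₀ hE1 (by norm_num)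
      have hE2 : 0 < energyConst α β ^ 2 := by positivity
      gcongr
      exact min_le_right _ _
    have hE2 : 0 < energyConst α β ^ 2 := by positivity
    have h5 : 2 / energyConst α β ^ 2 ≤ 1 - Ω := by
      rw [div_le_iff₀ hE2]; nlinarith
    have h6 : 0 ≤ 1 - Ω := le_trans (by positivity) h5
    have h7 := mul_le_mul_of_nonneg_right hp2 (by linarith : 0 ≤ (1 - Ω) / 2)
    linarith

/-! ### Second moments of certificate entries and residuals -/

section moments

variable {p : ℕ} {S : Finset (Fin p)} {α β s η g : ℝ}

theorem IsCovariance.expect_linear_mul_linear (h : IsCovariance S α β s η g) (a b : Fin p → ℝ) :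
    expect S α β (fun σ => (∑ i, a i * spin σ i) * ∑ i, b i * spin σ i) =
      s * (∑ i, a i * b i) + η * ((∑ i, a i) * ∑ i, b i) +
        g * ((∑ i, a i * blockVec S i) * ∑ i, b i * blockVec S i) := by
  have e1 : ∀ σ : Config p, (∑ i, a i * spin σ i) * ∑ i, b i * spin σ i =
      ∑ i, ∑ j, a i * b j * (spin σ i * spin σ j) := by
    intro σ
    rw [Finset.sum_mul_sum]
    exact Finset.sum_congr rfl fun i _ => Finset.sum_congr rfl fun j _ => by ring
  simp only [e1, expect_sum, expect_const_mul, h.expect_eq]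
  have e2 : ∀ i j, a i * b j * ((if i = j then s else 0) + η + g * (blockVec S i * blockVec S j)) =
      (if i = j then s * (a i * b j) else 0) + η * (a i * b j) +
        g * ((a i * blockVec S i) * (b j * blockVec S j)) := by
    intro i j
    split_ifs <;> ring
  simp only [e2, Finset.sum_add_distrib, Finset.sum_ite_eq, Finset.mem_univ, if_true,
    ← Finset.mul_sum]
  simp only [← Finset.sum_mul]

theorem sum_blockVec_mul_self (S : Finset (Fin p)) : ∑ i, blockVec S i * blockVec S i = p := by
  simp [blockVec_mul_self]

theorem IsCovariance.expect_contrast_sq (h : IsCovariance S α β s η g) (hS : 2 * S.card = p) :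
    expect S α β (fun σ => contrast S σ ^ 2) = p * (s + p * g) := by
  have := h.expect_linear_mul_linear (blockVec S) (blockVec S)
  simp only [sum_blockVec_mul_self, sum_blockVec hS] at this
  simp only [pow_two, contrast]
  rw [this]
  ring

/-- All diagonal entries of the dual certificate have the same mean `s + p g`. -/
theorem IsCovariance.expect_certEntry (h : IsCovariance S α β s η g) (hp : 0 < p)
    (hS : 2 * S.card = p) (i : Fin p) :
    expect S α β (certEntry S i) = s + p * g := by
  have hp' : (p : ℝ) ≠ 0 := by positivity
  have e : ∀ σ, certEntry S i σ = (∑ j, (blockVec S i * ((if j = i then 1 else 0) - 1 / p)) *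
      spin σ j) * ∑ j, blockVec S j * spin σ j := by
    intro σ
    rw [certEntry, contrast]
    congr 1
    have : ∀ j, blockVec S i * ((if j = i then 1 else 0) - 1 / (p : ℝ)) * spin σ j =
        (if j = i then blockVec S i * spin σ j else 0) - blockVec S i / p * spin σ j := by
      intro j; split_ifs <;> ring
    simp only [this, Finset.sum_sub_distrib, Finset.sum_ite_eq', Finset.mem_univ, if_true,
      ← Finset.mul_sum]
    rw [magnetization]; ring
  have e' : certEntry S i = fun σ => (∑ j, (blockVec S i * ((if j = i then 1 else 0) - 1 / p)) *
      spin σ j) * ∑ j, blockVec S j * spin σ j := funext e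
  rw [e', h.expect_linear_mul_linear]
  have e3 : ∑ j, blockVec S i * ((if j = i then 1 else 0) - 1 / (p : ℝ)) * blockVec S j = 1 := by
    have : ∀ j, blockVec S i * ((if j = i then 1 else 0) - 1 / (p : ℝ)) * blockVec S j =
        (if j = i then blockVec S i * blockVec S j else 0) - blockVec S i / p * blockVec S j := by
      intro j; split_ifs <;> ring
    simp only [this, Finset.sum_sub_distrib, Finset.sum_ite_eq', Finset.mem_univ, if_true,
      ← Finset.mul_sum, sum_blockVec hS, blockVec_mul_self]
    ring
  rw [e3, sum_blockVec hS, sum_blockVec_mul_self]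
  ring

theorem abs_certEntry_le_contrast (S : Finset (Fin p)) (i : Fin p) (σ : Config p) :
    |certEntry S i σ| ≤ 2 * |contrast S σ| := by
  rw [certEntry, abs_mul, abs_mul, abs_blockVec, one_mul]
  refine mul_le_mul_of_nonneg_right ?_ (abs_nonneg _)
  refine (abs_sub _ _).trans ?_
  rw [abs_spin, abs_div, Nat.abs_cast]
  have := div_le_one_of_le₀ (abs_magnetization_le σ) (Nat.cast_nonneg p)
  linarith

theorem abs_certEntry_le (S : Finset (Fin p)) (i : Fin p) (σ : Config p) :
    |certEntry S i σ| ≤ 2 * p :=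
  (abs_certEntry_le_contrast S i σ).trans (by linarith [abs_contrast_le S σ])

theorem certEntry_sq_le (S : Finset (Fin p)) (i : Fin p) (σ : Config p) :
    certEntry S i σ ^ 2 ≤ 4 * contrast S σ ^ 2 := by
  have := pow_le_pow_left₀ (abs_nonneg _) (abs_certEntry_le_contrast S i σ) 2
  rw [mul_pow, sq_abs, sq_abs] at this
  linarith

/-- The residuals have variance at most `s` in every direction. -/
theorem IsCovariance.expect_residual_sq_le (h : IsCovariance S α β s η g) (hp : 0 < p)
    (hS : 2 * S.card = p) (u : Fin p → ℝ) :
    expect S α β (fun σ => (∑ i, u i * residual S σ i) ^ 2) ≤ s * ∑ i, u i ^ 2 := by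
  have hp' : (p : ℝ) ≠ 0 := by positivity
  set m := (∑ i, u i) / p with hm
  set c := (∑ i, u i * blockVec S i) / p with hc
  have hm' : ∑ i, u i = m * p := by rw [hm, div_mul_cancel₀ _ hp']
  have hc' : ∑ i, u i * blockVec S i = c * p := by rw [hc, div_mul_cancel₀ _ hp']
  set a : Fin p → ℝ := fun i => u i - m - c * blockVec S i with ha
  have e : ∀ σ : Config p, ∑ i, u i * residual S σ i = ∑ i, a i * spin σ i := by
    intro σ
    have h1 : ∑ i, u i * residual S σ i = ∑ i, u i * spin σ i -
        magnetization σ / p * ∑ i, u i - contrast S σ / p * ∑ i, u i * blockVec S i := by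
      simp only [residual, Finset.mul_sum, ← Finset.sum_sub_distrib]
      exact Finset.sum_congr rfl fun i _ => by ring
    have h2 : ∑ i, a i * spin σ i = ∑ i, u i * spin σ i - m * magnetization σ -
        c * contrast S σ := by
      simp only [ha, magnetization, contrast, Finset.mul_sum, ← Finset.sum_sub_distrib]
      exact Finset.sum_congr rfl fun i _ => by ring
    rw [h1, h2, hm', hc']
    field_simp
  have ha1 : ∑ i, a i = 0 := by
    simp only [ha, Finset.sum_sub_distrib, ← Finset.mul_sum, sum_blockVec hS, hm']
    simp; ring
  have ha2 : ∑ i, a i * blockVec S i = 0 := by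
    simp only [ha, sub_mul, Finset.sum_sub_distrib, ← Finset.mul_sum, sum_blockVec hS, hc',
      mul_assoc, sum_blockVec_mul_self]
    ring
  have ha3 : ∑ i, a i * a i ≤ ∑ i, u i ^ 2 := by
    have : ∑ i, u i ^ 2 = ∑ i, a i * a i + 2 * m * ∑ i, a i + 2 * c * ∑ i, a i * blockVec S i +
        ∑ i, (m + c * blockVec S i) ^ 2 := by
      simp only [ha, Finset.mul_sum, ← Finset.sum_add_distrib]
      exact Finset.sum_congr rfl fun i _ => by ring
    rw [this, ha1, ha2]
    have : 0 ≤ ∑ i, (m + c * blockVec S i) ^ 2 := Finset.sum_nonneg fun i _ => sq_nonneg _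
    linarith
  simp only [e, pow_two]
  rw [h.expect_linear_mul_linear, ha1, ha2]
  simp only [mul_zero, add_zero]
  simp only [← pow_two] at ha3 ⊢
  exact mul_le_mul_of_nonneg_left ha3 h.nonneg

end moments

/-! ### Sub-Gaussian residuals -/

theorem swap_mem_iff {ι : Type*} [DecidableEq ι] {T : Finset ι} {i j : ι} (hi : i ∈ T) (hj : j ∈ T)
    (x : ι) : Equiv.swap i j x ∈ T ↔ x ∈ T := by
  rw [Equiv.swap_apply_def]
  split_ifs with h1 h2
  · simp [h1, hi, hj]
  · simp [h2, hi, hj]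
  · rfl

theorem sum_spin_comp_swap {p : ℕ} {T : Finset (Fin p)} {i j : Fin p} (hi : i ∈ T) (hj : j ∈ T)
    (σ : Config p) : ∑ x ∈ T, spin (σ ∘ Equiv.swap i j) x = ∑ x ∈ T, spin σ x :=
  Finset.sum_equiv (Equiv.swap i j) (fun x => (swap_mem_iff hi hj x).symm) fun _ _ => rfl

theorem exp_mul_spin {p : ℕ} (t : ℝ) (σ : Config p) (i : Fin p) :
    Real.exp (t * spin σ i) = Real.cosh t + spin σ i * Real.sinh t := by
  unfold spin
  rcases Int.units_eq_one_or (σ i) with h | h <;>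
    simp [h, Real.cosh_add_sinh, ← sub_eq_add_neg, Real.cosh_sub_sinh]

/-- A weight `φ` is exchangeable on `T` if it is invariant under transpositions of sites in `T`. -/
def ExchangeableOn {p : ℕ} (T : Finset (Fin p)) (φ : Config p → ℝ) : Prop :=
  ∀ i ∈ T, ∀ j ∈ T, ∀ σ, φ (σ ∘ Equiv.swap i j) = φ σ

/-- Given the spin sum over `T`, each spin in `T` has conditional mean equal to the average over
`T`, and its centered version is sub-Gaussian. -/
theorem sum_mul_exp_centered_spin_le {p : ℕ} {T : Finset (Fin p)} {φ : Config p → ℝ}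
    (hφ : ∀ σ, 0 ≤ φ σ) (hT : ExchangeableOn T φ) {k : Fin p} (hk : k ∈ T) (t : ℝ) :
    ∑ σ, φ σ * Real.exp (t * (spin σ k - (∑ i ∈ T, spin σ i) / T.card)) ≤
      Real.exp (t ^ 2) * ∑ σ, φ σ := by
  have hcard : (0 : ℝ) < T.card := by exact_mod_cast Finset.card_pos.2 ⟨k, hk⟩
  set q : Config p → ℝ := fun σ => (∑ i ∈ T, spin σ i) / T.card with hq
  have hq1 : ∀ σ, |q σ| ≤ 1 := by
    intro σ
    rw [hq, abs_div, Nat.abs_cast, div_le_one hcard]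
    refine (Finset.abs_sum_le_sum_abs _ _).trans ?_
    simp [abs_spin]
  set ψ : Config p → ℝ := fun σ => φ σ * Real.exp (-t * q σ) with hψ
  have hψk : ∀ i ∈ T, ∑ σ, ψ σ * spin σ i = ∑ σ, ψ σ * spin σ k := by
    intro i hi
    rw [← sum_comp_perm (Equiv.swap i k)]
    refine Finset.sum_congr rfl fun σ _ => ?_
    have e1 : ψ (σ ∘ Equiv.swap i k) = ψ σ := by
      simp only [hψ, hq, sum_spin_comp_swap hi hk, hT i hi k hk]
    have e2 : spin (σ ∘ Equiv.swap i k) i = spin σ k := by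
      unfold spin; rw [Function.comp_apply, Equiv.swap_apply_left]
    rw [e1, e2]
  have hmean : ∑ σ, ψ σ * spin σ k = ∑ σ, ψ σ * q σ := by
    have h1 : ∑ i ∈ T, ∑ σ, ψ σ * spin σ i = T.card * ∑ σ, ψ σ * spin σ k := by
      rw [Finset.sum_congr rfl hψk, Finset.sum_const, nsmul_eq_mul]
    rw [Finset.sum_comm] at h1
    have h2 : ∑ σ, ψ σ * q σ = (∑ σ, ∑ i ∈ T, ψ σ * spin σ i) / T.card := by
      rw [Finset.sum_div]
      refine Finset.sum_congr rfl fun σ _ => ?_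
      rw [← Finset.mul_sum, hq, mul_div_assoc]
    rw [h2, h1, mul_div_cancel_left₀ _ hcard.ne']
  have h1 : ∑ σ, φ σ * Real.exp (t * (spin σ k - q σ)) =
      Real.cosh t * (∑ σ, ψ σ) + Real.sinh t * ∑ σ, ψ σ * spin σ k := by
    rw [Finset.mul_sum, Finset.mul_sum, ← Finset.sum_add_distrib]
    refine Finset.sum_congr rfl fun σ _ => ?_
    rw [show t * (spin σ k - q σ) = t * spin σ k + -t * q σ by ring, Real.exp_add, exp_mul_spin]
    simp only [hψ]
    ring
  change ∑ σ, φ σ * Real.exp (t * (spin σ k - q σ)) ≤ _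
  rw [h1, hmean, Finset.mul_sum, Finset.mul_sum, Finset.mul_sum, ← Finset.sum_add_distrib]
  refine Finset.sum_le_sum fun σ _ => ?_
  have hm : Real.exp (-t * q σ) ≤ Real.cosh t - q σ * Real.sinh t := by
    have := Real.exp_mul_le_cosh_add_mul_sinh (hq1 σ) (-t)
    rw [Real.cosh_neg, Real.sinh_neg] at this
    rw [mul_comm]
    linarith
  have hp : 0 ≤ Real.cosh t + q σ * Real.sinh t :=
    (Real.exp_pos _).le.trans (Real.exp_mul_le_cosh_add_mul_sinh (hq1 σ) t)
  -- Bounding the centering factor by `hm` turns the product into a difference of squares.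
  have h2 : Real.exp (-t * q σ) * (Real.cosh t + q σ * Real.sinh t) ≤ Real.exp (t ^ 2) := by
    calc _ ≤ (Real.cosh t - q σ * Real.sinh t) * (Real.cosh t + q σ * Real.sinh t) :=
          mul_le_mul_of_nonneg_right hm hp
      _ = Real.cosh t ^ 2 - (q σ * Real.sinh t) ^ 2 := by ring
      _ ≤ Real.cosh t ^ 2 := by linarith [sq_nonneg (q σ * Real.sinh t)]
      _ ≤ Real.exp (t ^ 2 / 2) ^ 2 :=
          pow_le_pow_left₀ (Real.cosh_pos t).le (Real.cosh_le_exp_half_sq t) 2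
      _ = Real.exp (t ^ 2) := by rw [← Real.exp_nat_mul]; congr 1; push_cast; ring
  calc Real.cosh t * ψ σ + Real.sinh t * (ψ σ * q σ)
      = φ σ * (Real.exp (-t * q σ) * (Real.cosh t + q σ * Real.sinh t)) := by
        simp only [hψ]; ring
    _ ≤ φ σ * Real.exp (t ^ 2) := mul_le_mul_of_nonneg_left h2 (hφ σ)
    _ = _ := mul_comm _ _

/-- Linear statistics of an exchangeable family of spins, centered given the spin sum, are
sub-Gaussian. Spins are revealed one at a time; each increment is controlled by
`sum_mul_exp_centered_spin_le`, and the squared increments add up to the empirical variance. -/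
theorem sum_mul_exp_linear_le {p : ℕ} (u : Fin p → ℝ) (T : Finset (Fin p)) :
    ∀ φ : Config p → ℝ, (∀ σ, 0 ≤ φ σ) → ExchangeableOn T φ →
      ∑ σ, φ σ * Real.exp ((∑ i ∈ T, u i * spin σ i) -
          (∑ i ∈ T, u i) * (∑ i ∈ T, spin σ i) / T.card) ≤
        Real.exp (2 * ((∑ i ∈ T, u i ^ 2) - (∑ i ∈ T, u i) ^ 2 / T.card)) * ∑ σ, φ σ := by
  induction T using Finset.induction_on with
  | empty => intro φ _ _; simp
  | insert k T hkT ih =>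
    intro φ hφ hex
    rcases T.eq_empty_or_nonempty with rfl | hne
    · simp
    have hm : (1 : ℝ) ≤ T.card := by exact_mod_cast hne.card_pos
    have hm0 : (0 : ℝ) < T.card := by linarith
    set U := ∑ i ∈ T, u i with hU
    -- The increment due to `σ_k` is its centered value times `t`.
    set t := u k - U / T.card with ht
    set φ' : Config p → ℝ := fun σ => φ σ *
      Real.exp (t * (spin σ k - (∑ i ∈ insert k T, spin σ i) / (insert k T).card)) with hφ'
    have hφ'0 : ∀ σ, 0 ≤ φ' σ := fun σ => mul_nonneg (hφ σ) (Real.exp_pos _).le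
    have hex' : ExchangeableOn T φ' := by
      intro i hi j hj σ
      have hi' := Finset.mem_insert_of_mem (b := k) hi
      have hj' := Finset.mem_insert_of_mem (b := k) hj
      have e : spin (σ ∘ Equiv.swap i j) k = spin σ k := by
        unfold spin
        rw [Function.comp_apply, Equiv.swap_apply_of_ne_of_ne]
        · rintro rfl; exact hkT hi
        · rintro rfl; exact hkT hj
      simp only [hφ', hex i hi' j hj', sum_spin_comp_swap hi' hj', e]
    have h1 := ih φ' hφ'0 hex'
    have h2 := sum_mul_exp_centered_spin_le hφ hex (Finset.mem_insert_self k T) t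
    have hcard : ((insert k T).card : ℝ) = T.card + 1 := by
      rw [Finset.card_insert_of_notMem hkT]; push_cast; rfl
    have e1 : ∀ σ : Config p, φ σ * Real.exp ((∑ i ∈ insert k T, u i * spin σ i) -
        (∑ i ∈ insert k T, u i) * (∑ i ∈ insert k T, spin σ i) / (insert k T).card) =
        φ' σ * Real.exp ((∑ i ∈ T, u i * spin σ i) - U * (∑ i ∈ T, spin σ i) / T.card) := by
      intro σ
      simp only [hφ']
      rw [mul_assoc, ← Real.exp_add, hcard, Finset.sum_insert hkT, Finset.sum_insert hkT,
        Finset.sum_insert hkT, ← hU, ht]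
      congr 2
      field_simp
      ring
    have e2 : (∑ i ∈ T, u i ^ 2) - U ^ 2 / T.card + t ^ 2 / 2 ≤
        (∑ i ∈ insert k T, u i ^ 2) - (∑ i ∈ insert k T, u i) ^ 2 / (insert k T).card := by
      rw [hcard, Finset.sum_insert hkT, Finset.sum_insert hkT, ← hU]
      have : u k ^ 2 + ∑ i ∈ T, u i ^ 2 - (u k + U) ^ 2 / (T.card + 1) =
          (∑ i ∈ T, u i ^ 2) - U ^ 2 / T.card + T.card / (T.card + 1) * t ^ 2 := by
        rw [ht]; field_simp; ring
      rw [this]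
      have h3 : (1 : ℝ) / 2 ≤ T.card / (T.card + 1) := by
        rw [div_le_div_iff₀ (by norm_num) (by linarith)]; linarith
      have := mul_le_mul_of_nonneg_right h3 (sq_nonneg t)
      linarith
    rw [Finset.sum_congr rfl fun σ _ => e1 σ]
    calc _ ≤ Real.exp (2 * ((∑ i ∈ T, u i ^ 2) - U ^ 2 / T.card)) * ∑ σ, φ' σ := h1
      _ ≤ Real.exp (2 * ((∑ i ∈ T, u i ^ 2) - U ^ 2 / T.card)) *
          (Real.exp (t ^ 2) * ∑ σ, φ σ) := mul_le_mul_of_nonneg_left h2 (Real.exp_pos _).le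
      _ = Real.exp (2 * ((∑ i ∈ T, u i ^ 2) - U ^ 2 / T.card + t ^ 2 / 2)) * ∑ σ, φ σ := by
          rw [← mul_assoc, ← Real.exp_add]; congr 2; ring
      _ ≤ _ := by
          refine mul_le_mul_of_nonneg_right (Real.exp_le_exp.2 ?_)
            (Finset.sum_nonneg fun σ _ => hφ σ)
          linarith

section residual

variable {p : ℕ} {S : Finset (Fin p)}

theorem magnetization_eq (S : Finset (Fin p)) (σ : Config p) :
    magnetization σ = ∑ i ∈ S, spin σ i + ∑ i ∈ Sᶜ, spin σ i :=
  (Finset.sum_add_sum_compl S _).symm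

theorem contrast_eq (S : Finset (Fin p)) (σ : Config p) :
    contrast S σ = ∑ i ∈ S, spin σ i - ∑ i ∈ Sᶜ, spin σ i := by
  rw [contrast, ← Finset.sum_add_sum_compl S, sub_eq_add_neg, ← Finset.sum_neg_distrib]
  congr 1
  · exact Finset.sum_congr rfl fun i hi => by simp [blockVec, hi]
  · refine Finset.sum_congr rfl fun i hi => ?_
    rw [Finset.mem_compl] at hi
    simp [blockVec, hi]

/-- On each block the residual is the spin minus the block average. -/
theorem sum_mul_residual (hS : 2 * S.card = p) (hp : 0 < p) (u : Fin p → ℝ) (σ : Config p) :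
    ∑ i, u i * residual S σ i =
      ((∑ i ∈ S, u i * spin σ i) - (∑ i ∈ S, u i) * (∑ i ∈ S, spin σ i) / S.card) +
      ((∑ i ∈ Sᶜ, u i * spin σ i) - (∑ i ∈ Sᶜ, u i) * (∑ i ∈ Sᶜ, spin σ i) / Sᶜ.card) := by
  have hc : Sᶜ.card = S.card := by
    rw [Finset.card_compl, Fintype.card_fin]; omega
  have hS0 : (S.card : ℝ) ≠ 0 := by
    have : S.card ≠ 0 := by omega
    exact_mod_cast this
  have hpS : (p : ℝ) = 2 * S.card := by exact_mod_cast hS.symm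
  rw [← Finset.sum_add_sum_compl S, hc]
  congr 1
  · rw [Finset.sum_mul, Finset.sum_div, ← Finset.sum_sub_distrib]
    refine Finset.sum_congr rfl fun i hi => ?_
    have hb : blockVec S i = 1 := by simp [blockVec, hi]
    rw [residual, hb, magnetization_eq S, contrast_eq S, hpS]
    field_simp
    ring
  · rw [Finset.sum_mul, Finset.sum_div, ← Finset.sum_sub_distrib]
    refine Finset.sum_congr rfl fun i hi => ?_
    have hb : blockVec S i = -1 := by simp [blockVec, Finset.mem_compl.1 hi]
    rw [residual, hb, magnetization_eq S, contrast_eq S, hpS]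
    field_simp
    ring

/-- The residuals are sub-Gaussian in every direction. -/
theorem expect_exp_sum_mul_residual_le (hS : 2 * S.card = p) (hp : 0 < p) (α β : ℝ)
    (u : Fin p → ℝ) :
    expect S α β (fun σ => Real.exp (∑ i, u i * residual S σ i)) ≤
      Real.exp (2 * ∑ i, u i ^ 2) := by
  have hexS : ExchangeableOn S (density S α β) := fun i hi j hj σ =>
    density_comp_of_respectsBlocks (respectsBlocks_swap (by simp [blockVec, hi, hj])) σ
  set φ : Config p → ℝ := fun σ => density S α β σ *
    Real.exp ((∑ i ∈ S, u i * spin σ i) - (∑ i ∈ S, u i) * (∑ i ∈ S, spin σ i) / S.card) with hφ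
  have hφ0 : ∀ σ, 0 ≤ φ σ := fun σ => mul_nonneg (density_pos S α β σ).le (Real.exp_pos _).le
  have hexC : ExchangeableOn Sᶜ φ := by
    intro i hi j hj σ
    have hi' := Finset.mem_compl.1 hi
    have hj' := Finset.mem_compl.1 hj
    have h1 : ∀ x ∈ S, spin (σ ∘ Equiv.swap i j) x = spin σ x := by
      intro x hx
      unfold spin
      rw [Function.comp_apply, Equiv.swap_apply_of_ne_of_ne]
      · rintro rfl; exact hi' hx
      · rintro rfl; exact hj' hx
    have h2 : density S α β (σ ∘ Equiv.swap i j) = density S α β σ :=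
      density_comp_of_respectsBlocks (respectsBlocks_swap (by simp [blockVec, hi', hj'])) σ
    simp only [hφ, h2]
    rw [Finset.sum_congr rfl h1, Finset.sum_congr rfl fun x hx => by rw [h1 x hx]]
  have k1 := sum_mul_exp_linear_le u S _ (fun σ => (density_pos S α β σ).le) hexS
  have k2 := sum_mul_exp_linear_le u Sᶜ φ hφ0 hexC
  have e : expect S α β (fun σ => Real.exp (∑ i, u i * residual S σ i)) =
      ∑ σ, φ σ * Real.exp ((∑ i ∈ Sᶜ, u i * spin σ i) -
          (∑ i ∈ Sᶜ, u i) * (∑ i ∈ Sᶜ, spin σ i) / Sᶜ.card) := by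
    refine Finset.sum_congr rfl fun σ _ => ?_
    simp only [hφ]
    rw [sum_mul_residual hS hp, Real.exp_add, ← mul_assoc]
  rw [sum_density, mul_one] at k1
  rw [e]
  refine k2.trans ((mul_le_mul_of_nonneg_left k1 (Real.exp_pos _).le).trans ?_)
  rw [← Real.exp_add, Real.exp_le_exp, ← Finset.sum_add_sum_compl S fun i => u i ^ 2]
  have h1 : 0 ≤ (∑ i ∈ S, u i) ^ 2 / S.card := by positivity
  have h2 : 0 ≤ (∑ i ∈ Sᶜ, u i) ^ 2 / Sᶜ.card := by positivity
  linarith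

end residual

theorem exp_sub_sq_eq (x s : ℝ) : Real.exp (s * x - 16 * s ^ 2) =
    Real.exp (x ^ 2 / 64) * Real.exp (-16 * (s - x / 32) ^ 2) := by
  rw [← Real.exp_add]; congr 1; ring

theorem integrable_exp_sub_sq (x : ℝ) : Integrable fun s : ℝ => Real.exp (s * x - 16 * s ^ 2) := by
  simp only [exp_sub_sq_eq]
  exact ((integrable_exp_neg_mul_sq (b := 16) (by norm_num)).comp_sub_right (x / 32)).const_mul _

theorem integral_exp_sub_sq (x : ℝ) : ∫ s : ℝ, Real.exp (s * x - 16 * s ^ 2) =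
    Real.exp (x ^ 2 / 64) * √(Real.pi / 16) := by
  simp only [exp_sub_sq_eq]
  rw [integral_const_mul, integral_sub_right_eq_self (fun s : ℝ => Real.exp (-16 * s ^ 2)),
    integral_gaussian]

/-- Exponential moment of the square of a sub-Gaussian variable, by Gaussian linearization
of the square. -/
theorem expect_exp_sq_le {p : ℕ} (S : Finset (Fin p)) (α β : ℝ) (Y : Config p → ℝ)
    (hY : ∀ s : ℝ, expect S α β (fun σ => Real.exp (s * Y σ)) ≤ Real.exp (8 * s ^ 2)) :
    expect S α β (fun σ => Real.exp (Y σ ^ 2 / 64)) ≤ 2 := by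
  have h1 : expect S α β (fun σ => Real.exp (Y σ ^ 2 / 64)) * √(Real.pi / 16) =
      ∫ s : ℝ, ∑ σ, density S α β σ * Real.exp (s * Y σ - 16 * s ^ 2) := by
    rw [integral_finsetSum _ fun σ _ => (integrable_exp_sub_sq (Y σ)).const_mul _]
    simp only [integral_const_mul, integral_exp_sub_sq, expect, Finset.sum_mul, mul_assoc]
  have h2 : ∫ s : ℝ, ∑ σ, density S α β σ * Real.exp (s * Y σ - 16 * s ^ 2) ≤
      ∫ s : ℝ, Real.exp (-8 * s ^ 2) := by
    refine integral_mono (integrable_finsetSum _ fun σ _ =>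
      (integrable_exp_sub_sq (Y σ)).const_mul _) (integrable_exp_neg_mul_sq (by norm_num))
      fun s => ?_
    have : ∑ σ, density S α β σ * Real.exp (s * Y σ - 16 * s ^ 2) =
        expect S α β (fun σ => Real.exp (s * Y σ)) * Real.exp (-(16 * s ^ 2)) := by
      rw [expect, Finset.sum_mul]
      refine Finset.sum_congr rfl fun σ _ => ?_
      rw [mul_assoc, ← Real.exp_add, sub_eq_add_neg]
    change ∑ σ, density S α β σ * Real.exp (s * Y σ - 16 * s ^ 2) ≤ Real.exp (-8 * s ^ 2)
    rw [this]
    refine (mul_le_mul_of_nonneg_right (hY s) (Real.exp_pos _).le).trans ?_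
    rw [← Real.exp_add, Real.exp_le_exp]
    linarith
  rw [← h1, integral_gaussian] at h2
  have h3 : √(Real.pi / 8) ≤ 2 * √(Real.pi / 16) := by
    rw [show (2 : ℝ) = √4 by rw [show (4 : ℝ) = 2 ^ 2 by norm_num]; simp,
      ← Real.sqrt_mul (by norm_num)]
    apply Real.sqrt_le_sqrt
    linarith [Real.pi_pos]
  have h4 : 0 < √(Real.pi / 16) := Real.sqrt_pos.2 (by linarith [Real.pi_pos])
  exact le_of_mul_le_mul_right (h2.trans h3) h4

theorem exp_le_one_add_add_sq_mul_exp {x : ℝ} (hx : 0 ≤ x) :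
    Real.exp x ≤ 1 + x + x ^ 2 * Real.exp x := by
  have h1 : 1 - x ≤ Real.exp (-x) := by linarith [Real.add_one_le_exp (-x)]
  have h2 : Real.exp (-x) * Real.exp x = 1 := by rw [← Real.exp_add]; simp
  have h3 : (1 - x) * Real.exp x ≤ 1 :=
    (mul_le_mul_of_nonneg_right h1 (Real.exp_pos x).le).trans h2.le
  have h4 : Real.exp x - 1 ≤ x * Real.exp x := by linarith
  nlinarith [mul_le_mul_of_nonneg_left h4 hx]

/-- Exponential moments of squared residuals: the first-order term carries the sharp variance. -/
theorem IsCovariance.expect_exp_residual_sq_le {p : ℕ} {S : Finset (Fin p)} {α β s η g : ℝ}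
    (h : IsCovariance S α β s η g) (hp : 0 < p) (hS : 2 * S.card = p) (u : Fin p → ℝ)
    (hu : ∑ i, u i ^ 2 ≤ 4) {θ : ℝ} (hθ : 0 ≤ θ) (hθ' : θ ≤ 1 / 128) :
    expect S α β (fun σ => Real.exp (θ * (∑ i, u i * residual S σ i) ^ 2)) ≤
      Real.exp (θ * s * (∑ i, u i ^ 2) + 65536 * θ ^ 2) := by
  set Y : Config p → ℝ := fun σ => ∑ i, u i * residual S σ i with hY
  have hsub : ∀ t : ℝ, expect S α β (fun σ => Real.exp (t * Y σ)) ≤ Real.exp (8 * t ^ 2) := by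
    intro t
    have := expect_exp_sum_mul_residual_le hS hp α β (fun i => t * u i)
    simp only [mul_assoc, ← Finset.mul_sum, mul_pow] at this
    refine this.trans (Real.exp_le_exp.2 ?_)
    nlinarith [sq_nonneg t]
  have h64 := expect_exp_sq_le S α β Y hsub
  have hpt : ∀ σ, Real.exp (θ * Y σ ^ 2) ≤
      1 + θ * Y σ ^ 2 + 32768 * θ ^ 2 * Real.exp (Y σ ^ 2 / 64) := by
    intro σ
    have hx : 0 ≤ θ * Y σ ^ 2 := by positivity
    refine (exp_le_one_add_add_sq_mul_exp hx).trans ?_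
    have hq := Real.quadratic_le_exp_of_nonneg (by positivity : 0 ≤ Y σ ^ 2 / 128)
    have h1 : (Y σ ^ 2 / 128) ^ 2 ≤ 2 * Real.exp (Y σ ^ 2 / 128) := by
      have : 0 ≤ Y σ ^ 2 / 128 := by positivity
      linarith
    have h2 : Real.exp (θ * Y σ ^ 2) ≤ Real.exp (Y σ ^ 2 / 128) := by
      rw [Real.exp_le_exp]
      nlinarith [sq_nonneg (Y σ)]
    have h3 : (Y σ ^ 2 / 128) ^ 2 * Real.exp (θ * Y σ ^ 2) ≤ 2 * Real.exp (Y σ ^ 2 / 64) := by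
      calc _ ≤ 2 * Real.exp (Y σ ^ 2 / 128) * Real.exp (Y σ ^ 2 / 128) :=
            mul_le_mul h1 h2 (Real.exp_pos _).le (by positivity)
        _ = 2 * Real.exp (Y σ ^ 2 / 64) := by
            rw [mul_assoc, ← Real.exp_add]; congr 2; ring
    have h4 := mul_le_mul_of_nonneg_left h3 (by positivity : 0 ≤ 16384 * θ ^ 2)
    nlinarith
  calc _ ≤ expect S α β (fun σ => 1 + θ * Y σ ^ 2 +
        32768 * θ ^ 2 * Real.exp (Y σ ^ 2 / 64)) := expect_mono hpt
    _ = 1 + θ * expect S α β (fun σ => Y σ ^ 2) +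
        32768 * θ ^ 2 * expect S α β (fun σ => Real.exp (Y σ ^ 2 / 64)) := by
        rw [expect_add, expect_add, expect_const, expect_const_mul, expect_const_mul]
    _ ≤ 1 + θ * (s * ∑ i, u i ^ 2) + 32768 * θ ^ 2 * 2 := by
        have := h.expect_residual_sq_le hp hS u
        gcongr
    _ ≤ _ := by
        have := Real.add_one_le_exp (θ * s * (∑ i, u i ^ 2) + 65536 * θ ^ 2)
        linarith

/-! ### Concentration for independent observations -/

section sample

variable {p : ℕ} {S : Finset (Fin p)} {α β : ℝ}

theorem integral_sampleLaw_prod (n : ℕ) (f : Config p → ℝ) :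
    ∫ x, ∏ t, f (x t) ∂(sampleLaw n S α β) = expect S α β f ^ n := by
  rw [sampleLaw, integral_fintype_prod_eq_pow, integral_ibm, Fintype.card_fin]

theorem integral_sampleLaw_exp_sum (n : ℕ) (f : Config p → ℝ) :
    ∫ x, Real.exp (∑ t, f (x t)) ∂(sampleLaw n S α β) =
      expect S α β (fun σ => Real.exp (f σ)) ^ n := by
  simp only [Real.exp_sum]
  exact integral_sampleLaw_prod n fun σ => Real.exp (f σ)

/-- Chernoff bound for sums over independent observations. -/
theorem sampleLaw_real_le_exp (n : ℕ) (f : Config p → ℝ) (a : ℝ) :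
    (sampleLaw n S α β).real {x | a ≤ ∑ t, f (x t)} ≤
      Real.exp (-a) * expect S α β (fun σ => Real.exp (f σ)) ^ n := by
  have h := mul_meas_ge_le_integral_of_nonneg (μ := sampleLaw n S α β)
    (f := fun x => Real.exp (∑ t, f (x t))) (ae_of_all _ fun x => (Real.exp_pos _).le)
    .of_finite (Real.exp a)
  simp only [Real.exp_le_exp] at h
  rw [integral_sampleLaw_exp_sum] at h
  rw [Real.exp_neg, ← div_eq_inv_mul, le_div_iff₀ (Real.exp_pos a), mul_comm]
  exact h

/-- Lower tail of a diagonal entry of the dual certificate. The relative form of the bound uses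
that the second moment of an entry is at most `4 p` times its mean. -/
theorem sampleLaw_certEntry_le {s η g : ℝ} (h : IsCovariance S α β s η g) (hp : 0 < p)
    (hS : 2 * S.card = p) (hg : 0 ≤ g) (i : Fin p) (n : ℕ) {ε τ : ℝ} (hε : 0 < ε) (hε1 : ε ≤ 1)
    (hτ : τ ≤ n * ((1 - ε) * (s + p * g))) :
    (sampleLaw n S α β).real {x | ∑ t, certEntry S i (x t) ≤ τ} ≤
      Real.exp (-(n * ((s + p * g) * ε ^ 2 / (16 * p)))) := by
  have hp' : (0 : ℝ) < p := by positivity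
  set μ := s + p * g with hμ
  have hμ0 : 0 ≤ μ := by have := h.nonneg; positivity
  set l := ε / (8 * p) with hl
  have hl0 : 0 < l := by positivity
  have hlp : l * p = ε / 8 := by rw [hl]; field_simp
  have hmgf : expect S α β (fun σ => Real.exp (-l * certEntry S i σ)) ≤
      Real.exp (-l * μ + 4 * l ^ 2 * (p * μ)) := by
    have hpt : ∀ σ, Real.exp (-l * certEntry S i σ) ≤
        1 + -l * certEntry S i σ + 4 * l ^ 2 * contrast S σ ^ 2 := by
      intro σ
      have h1 : |-l * certEntry S i σ| ≤ 1 := by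
        rw [abs_mul, abs_neg, abs_of_pos hl0]
        have := mul_le_mul_of_nonneg_left (abs_certEntry_le S i σ) hl0.le
        linarith
      have h2 := (abs_le.1 (Real.abs_exp_sub_one_sub_id_le h1)).2
      have h3 := mul_le_mul_of_nonneg_left (certEntry_sq_le S i σ) (sq_nonneg l)
      nlinarith
    refine (expect_mono hpt).trans ?_
    rw [expect_add, expect_add, expect_const, expect_const_mul, expect_const_mul,
      h.expect_contrast_sq hS]
    have : expect S α β (fun σ => certEntry S i σ) = μ := h.expect_certEntry hp hS i
    rw [this]
    linarith [Real.add_one_le_exp (-l * μ + 4 * l ^ 2 * (p * μ))]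
  have hset : {x : Fin n → Config p | ∑ t, certEntry S i (x t) ≤ τ} =
      {x | -l * τ ≤ ∑ t, -l * certEntry S i (x t)} := by
    ext x
    simp only [Set.mem_ofPred_eq]
    rw [← Finset.mul_sum, neg_mul, neg_mul, neg_le_neg_iff, mul_le_mul_iff_right₀ hl0]
  rw [hset]
  refine (sampleLaw_real_le_exp n (fun σ => -l * certEntry S i σ) (-l * τ)).trans ?_
  calc _ ≤ Real.exp (-(-l * τ)) * Real.exp (-l * μ + 4 * l ^ 2 * (p * μ)) ^ n := by
        refine mul_le_mul_of_nonneg_left (pow_le_pow_left₀ ?_ hmgf n) (Real.exp_pos _).le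
        exact expect_nonneg fun σ => (Real.exp_pos _).le
    _ = Real.exp (l * τ + n * (-l * μ + 4 * l ^ 2 * (p * μ))) := by
        rw [← Real.exp_nat_mul, ← Real.exp_add]; congr 1; ring
    _ ≤ _ := by
        rw [Real.exp_le_exp]
        have h1 := mul_le_mul_of_nonneg_left hτ hl0.le
        have h2 : l * (n * ((1 - ε) * μ)) + n * (-l * μ + 4 * l ^ 2 * (p * μ)) =
            n * (l * μ * (-ε + 4 * (l * p))) := by ring
        have h3 : n * (l * μ * (-ε + 4 * (l * p))) = -(n * (μ * ε ^ 2 / (16 * p))) := by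
          rw [hlp, hl]; field_simp; ring
        linarith

open Metric in
/-- A quadratic form is controlled on the unit ball by its exponential integral over a larger ball:
`exp (θ Φ)` at a point is at most its average over any ball around that point. -/
theorem exp_mul_volume_closedBall_le {Φ : EuclideanSpace ℝ (Fin p) → ℝ} (hcont : Continuous Φ)
    (hnn : ∀ u, 0 ≤ Φ u) (hpar : ∀ u w, Φ (u + w) + Φ (u - w) = 2 * Φ u + 2 * Φ w) {θ r : ℝ}
    (hθ : 0 ≤ θ) {u : EuclideanSpace ℝ (Fin p)} (hu : ‖u‖ ≤ 1) :
    Real.exp (θ * Φ u) * volume.real (closedBall (0 : EuclideanSpace ℝ (Fin p)) r) ≤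
      ∫ w in closedBall (0 : EuclideanSpace ℝ (Fin p)) (1 + r), Real.exp (θ * Φ w) := by
  set F : EuclideanSpace ℝ (Fin p) → ℝ := fun w => Real.exp (θ * Φ w) with hF
  have hFc : Continuous F := by fun_prop
  have hint : ∀ (f : EuclideanSpace ℝ (Fin p) → ℝ), Continuous f → ∀ c R,
      IntegrableOn f (closedBall c R) := fun f hf c R =>
    hf.continuousOn.integrableOn_compact (isCompact_closedBall c R)
  have hadd : ∫ w in closedBall (0 : EuclideanSpace ℝ (Fin p)) r, F (u + w) =
      ∫ w in closedBall u r, F w := by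
    have := (measurePreserving_add_left volume u).setIntegral_preimage_emb
      (measurableEmbedding_addLeft u) F (closedBall u r)
    rw [← this]
    congr 2
    ext w
    simp
  have hsub : ∫ w in closedBall (0 : EuclideanSpace ℝ (Fin p)) r, F (u - w) =
      ∫ w in closedBall u r, F w := by
    have := (Measure.measurePreserving_sub_left volume u).setIntegral_preimage_emb
      (MeasurableEquiv.subLeft u).measurableEmbedding F (closedBall u r)
    rw [← this]
    congr 2
    ext w
    simp
  have hpt : ∀ w, F u ≤ (F (u + w) + F (u - w)) / 2 := by
    intro w
    simp only [hF]
    have h1 : Real.exp (θ * Φ u) ≤ Real.exp (θ * Φ (u + w) / 2 + θ * Φ (u - w) / 2) := by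
      rw [Real.exp_le_exp]
      have := mul_nonneg hθ (hnn w)
      have h2 := congrArg (θ * ·) (hpar u w)
      linarith
    refine h1.trans ?_
    rw [Real.exp_add]
    have e1 : Real.exp (θ * Φ (u + w)) = Real.exp (θ * Φ (u + w) / 2) ^ 2 := by
      rw [← Real.exp_nat_mul]; congr 1; push_cast; ring
    have e2 : Real.exp (θ * Φ (u - w)) = Real.exp (θ * Φ (u - w) / 2) ^ 2 := by
      rw [← Real.exp_nat_mul]; congr 1; push_cast; ring
    rw [e1, e2]
    nlinarith [sq_nonneg (Real.exp (θ * Φ (u + w) / 2) - Real.exp (θ * Φ (u - w) / 2))]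
  calc F u * volume.real (closedBall (0 : EuclideanSpace ℝ (Fin p)) r)
      = ∫ _ in closedBall (0 : EuclideanSpace ℝ (Fin p)) r, F u := by
        rw [setIntegral_const, smul_eq_mul, mul_comm]
    _ ≤ ∫ w in closedBall (0 : EuclideanSpace ℝ (Fin p)) r, (F (u + w) + F (u - w)) / 2 :=
        setIntegral_mono (hint _ (by fun_prop) _ _) (hint _ (by fun_prop) _ _) hpt
    _ = ∫ w in closedBall u r, F w := by
        rw [integral_div, integral_add (hint _ (by fun_prop) _ _) (hint _ (by fun_prop) _ _), hadd,
          hsub]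
        ring
    _ ≤ ∫ w in closedBall (0 : EuclideanSpace ℝ (Fin p)) (1 + r), F w := by
        refine setIntegral_mono_set (hint _ hFc _ _) (ae_of_all _ fun w => (Real.exp_pos _).le) ?_
        refine (closedBall_subset_closedBall' ?_).eventuallyLE
        rw [dist_zero_right]
        linarith

open Metric in
/-- Upper tail of the largest eigenvalue of a sum of rank-one matrices `z zᵀ`, `z` the residual of
an observation. Averaging the exponential moment over a ball replaces a union bound over a net. -/
theorem sampleLaw_exists_residual_gt_le {θ r b : ℝ} (hθ : 0 ≤ θ) (hr : 0 < r)
    (hb : ∀ u : Fin p → ℝ, ∑ i, u i ^ 2 ≤ (1 + r) ^ 2 →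
      expect S α β (fun σ => Real.exp (θ * (∑ i, u i * residual S σ i) ^ 2)) ≤ b)
    (n : ℕ) (τ : ℝ) :
    (sampleLaw n S α β).real {x | ∃ u : Fin p → ℝ,
        τ * ∑ i, u i ^ 2 < ∑ t, (∑ i, u i * residual S (x t) i) ^ 2} ≤
      ((1 + r) / r) ^ p * (Real.exp (-(θ * τ)) * b ^ n) := by
  set Φ : (Fin n → Config p) → EuclideanSpace ℝ (Fin p) → ℝ :=
    fun x u => ∑ t, (∑ i, u i * residual S (x t) i) ^ 2 with hΦ
  have hcont : ∀ x, Continuous (Φ x) := by intro x; simp only [hΦ]; fun_prop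
  set V : ℝ → ℝ := fun R => volume.real (closedBall (0 : EuclideanSpace ℝ (Fin p)) R) with hV
  have hVeq : ∀ R, 0 ≤ R → V R = R ^ p * V 1 := by
    intro R hR
    simp only [hV]
    rw [Measure.addHaar_real_closedBall' _ _ hR, finrank_euclideanSpace_fin]
  have hV1 : 0 < V 1 := by
    simp only [hV]
    exact ENNReal.toReal_pos (measure_closedBall_pos volume _ one_pos).ne'
      measure_closedBall_lt_top.ne
  have hVr : 0 < V r := by rw [hVeq r hr.le]; positivity
  set G : (Fin n → Config p) → ℝ := fun x =>
    ∫ w in closedBall (0 : EuclideanSpace ℝ (Fin p)) (1 + r), Real.exp (θ * Φ x w) with hG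
  have hG0 : ∀ x, 0 ≤ G x := fun x => integral_nonneg fun w => (Real.exp_pos _).le
  have hsub : {x | ∃ u : Fin p → ℝ,
      τ * ∑ i, u i ^ 2 < ∑ t, (∑ i, u i * residual S (x t) i) ^ 2} ⊆
      {x | Real.exp (θ * τ) * V r ≤ G x} := by
    rintro x ⟨u, hu⟩
    have hu0 : 0 < ∑ i, u i ^ 2 := by
      rcases (Finset.sum_nonneg fun i (_ : i ∈ Finset.univ) => sq_nonneg (u i)).lt_or_eq with h | h
      · exact h
      · have hz : ∀ i, u i = 0 := by
          intro i
          have := (Finset.sum_eq_zero_iff_of_nonneg fun i _ => sq_nonneg (u i)).1 h.symm i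
            (Finset.mem_univ i)
          simpa using this
        simp [hz] at hu
    set c := √(∑ i, u i ^ 2) with hc
    have hc0 : 0 < c := Real.sqrt_pos.2 hu0
    have hc2 : c ^ 2 = ∑ i, u i ^ 2 := Real.sq_sqrt hu0.le
    set v : EuclideanSpace ℝ (Fin p) := WithLp.toLp 2 fun i => u i / c with hv
    have hvn : ‖v‖ = 1 := by
      rw [EuclideanSpace.norm_eq, Real.sqrt_eq_one]
      simp only [hv, Real.norm_eq_abs, sq_abs, div_pow]
      rw [← Finset.sum_div, ← hc2, div_self (by positivity)]
    have hΦv : τ < Φ x v := by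
      have : Φ x v = (∑ t, (∑ i, u i * residual S (x t) i) ^ 2) / c ^ 2 := by
        simp only [hΦ, hv]
        rw [Finset.sum_div]
        refine Finset.sum_congr rfl fun t _ => ?_
        rw [← div_pow, Finset.sum_div]
        congr 1
        exact Finset.sum_congr rfl fun i _ => by ring
      rw [this, lt_div_iff₀ (by positivity), hc2]
      exact hu
    have key := exp_mul_volume_closedBall_le (hcont x)
      (fun u => Finset.sum_nonneg fun t _ => sq_nonneg _) (fun u w => by
        simp only [hΦ, PiLp.add_apply, PiLp.sub_apply, add_mul, sub_mul, Finset.sum_add_distrib,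
          Finset.sum_sub_distrib, Finset.mul_sum]
        rw [← Finset.sum_add_distrib, ← Finset.sum_add_distrib]
        exact Finset.sum_congr rfl fun t _ => by ring) (r := r) hθ hvn.le
    refine le_trans ?_ key
    refine mul_le_mul_of_nonneg_right (Real.exp_le_exp.2 ?_) hVr.le
    exact mul_le_mul_of_nonneg_left hΦv.le hθ
  have hGint : ∫ x, G x ∂(sampleLaw n S α β) ≤ b ^ n * V (1 + r) := by
    have hint : ∀ x, IntegrableOn (fun w => Real.exp (θ * Φ x w))
        (closedBall (0 : EuclideanSpace ℝ (Fin p)) (1 + r)) := fun x => by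
      have := hcont x
      exact Continuous.continuousOn (by fun_prop) |>.integrableOn_compact (isCompact_closedBall _ _)
    have e : ∫ x, G x ∂(sampleLaw n S α β) =
        ∫ w in closedBall (0 : EuclideanSpace ℝ (Fin p)) (1 + r),
          ∫ x, Real.exp (θ * Φ x w) ∂(sampleLaw n S α β) := by
      rw [integral_fintype .of_finite]
      have e1 : ∀ w, ∫ x, Real.exp (θ * Φ x w) ∂(sampleLaw n S α β) =
          ∑ x, (sampleLaw n S α β).real {x} * Real.exp (θ * Φ x w) := by
        intro w
        rw [integral_fintype .of_finite]
        rfl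
      simp only [e1]
      rw [integral_finsetSum _ fun x _ => (hint x).const_mul _]
      simp only [integral_const_mul, hG, smul_eq_mul]
    rw [e]
    have hbound : ∀ w ∈ closedBall (0 : EuclideanSpace ℝ (Fin p)) (1 + r),
        ∫ x, Real.exp (θ * Φ x w) ∂(sampleLaw n S α β) ≤ b ^ n := by
      intro w hw
      have e2 : ∀ x, θ * Φ x w = ∑ t, θ * (∑ i, w i * residual S (x t) i) ^ 2 := by
        intro x; simp only [hΦ, Finset.mul_sum]
      simp only [e2]
      rw [integral_sampleLaw_exp_sum n fun σ => θ * (∑ i, w i * residual S σ i) ^ 2]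
      refine pow_le_pow_left₀ (expect_nonneg fun σ => (Real.exp_pos _).le) (hb _ ?_) n
      rw [mem_closedBall_zero_iff] at hw
      rw [← EuclideanSpace.real_norm_sq_eq]
      exact pow_le_pow_left₀ (norm_nonneg _) hw 2
    have hcont' : Continuous fun w => ∫ x, Real.exp (θ * Φ x w) ∂(sampleLaw n S α β) := by
      have e1 : ∀ w, ∫ x, Real.exp (θ * Φ x w) ∂(sampleLaw n S α β) =
          ∑ x, (sampleLaw n S α β).real {x} * Real.exp (θ * Φ x w) := by
        intro w
        rw [integral_fintype .of_finite]
        rfl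
      simp only [e1]
      fun_prop
    have := setIntegral_mono_on (μ := volume)
      (hcont'.continuousOn.integrableOn_compact (isCompact_closedBall _ _))
      (integrableOn_const (measure_closedBall_lt_top (x := (0 : EuclideanSpace ℝ (Fin p)))).ne)
      measurableSet_closedBall hbound
    refine this.trans ?_
    rw [setIntegral_const, smul_eq_mul, mul_comm]
  have hM := mul_meas_ge_le_integral_of_nonneg (μ := sampleLaw n S α β) (f := G)
    (ae_of_all _ hG0) .of_finite (Real.exp (θ * τ) * V r)
  have hmono := measureReal_mono (μ := sampleLaw n S α β) hsub (measure_ne_top _ _)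
  refine hmono.trans ?_
  have hpos : 0 < Real.exp (θ * τ) * V r := by positivity
  rw [← mul_le_mul_iff_right₀ hpos]
  refine (hM.trans hGint).trans (le_of_eq ?_)
  rw [hVeq r hr.le, hVeq (1 + r) (by linarith), Real.exp_neg, div_pow]
  have := (Real.exp_pos (θ * τ)).ne'
  field_simp

/-- Failure probability of the semidefinite program, for any choice of the threshold `T` that
separates the diagonal of the dual certificate from the quadratic form of the residuals. -/
theorem sampleLaw_sdpRecovers_ge {s η g : ℝ} (h : IsCovariance S α β s η g) (hp : 0 < p)
    (hS : 2 * S.card = p) (hg : 0 ≤ g) {n : ℕ} (hn : 0 < n) {ε θ r T : ℝ} (hε : 0 < ε)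
    (hε1 : ε ≤ 1) (hθ : 0 ≤ θ) (hθ' : θ ≤ 1 / 128) (hr : 0 < r) (hr1 : r ≤ 1)
    (hT : T ≤ (1 - ε) * (s + p * g)) :
    1 - (p * Real.exp (-(n * ((s + p * g) * ε ^ 2 / (16 * p)))) +
        ((1 + r) / r) ^ p * Real.exp (-(n * (θ * (T - s * (1 + r) ^ 2 - 65536 * θ))))) ≤
      (sampleLaw n S α β).real {x | SDPRecovers S x} := by
  set P := sampleLaw n S α β
  set τ := n * T with hτ
  set A := {x : Fin n → Config p | ∃ u : Fin p → ℝ,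
        τ * ∑ i, u i ^ 2 < ∑ t, (∑ i, u i * residual S (x t) i) ^ 2} with hA
  set D : Fin p → Set (Fin n → Config p) := fun i => {x | ∑ t, certEntry S i (x t) ≤ τ} with hD
  have hcover : {x : Fin n → Config p | SDPRecovers S x}ᶜ ⊆ (⋃ i, D i) ∪ A := by
    intro x hx
    by_contra hcon
    simp only [Set.mem_union, Set.mem_iUnion, hD, hA, Set.mem_ofPred_eq, not_or, not_exists,
      not_le, not_lt] at hcon
    exact hx (sdpRecovers_of_certificate hn hp hS x τ hcon.1 hcon.2)
  have hDle : P.real (⋃ i, D i) ≤ p * Real.exp (-(n * ((s + p * g) * ε ^ 2 / (16 * p)))) := by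
    refine (measureReal_iUnion_fintype_le D).trans ?_
    refine (Finset.sum_le_sum fun i _ => sampleLaw_certEntry_le h hp hS hg i n hε hε1 ?_).trans ?_
    · rw [hτ]; exact mul_le_mul_of_nonneg_left hT (Nat.cast_nonneg n)
    · simp
  have hAle : P.real A ≤
      ((1 + r) / r) ^ p * Real.exp (-(n * (θ * (T - s * (1 + r) ^ 2 - 65536 * θ)))) := by
    have h4 : (1 + r) ^ 2 ≤ 4 := by nlinarith
    refine (sampleLaw_exists_residual_gt_le (b := Real.exp (θ * s * (1 + r) ^ 2 + 65536 * θ ^ 2))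
      hθ hr (fun u hu => ?_) n τ).trans (le_of_eq ?_)
    · refine (h.expect_exp_residual_sq_le hp hS u (hu.trans h4) hθ hθ').trans ?_
      rw [Real.exp_le_exp]
      have := mul_le_mul_of_nonneg_left hu (mul_nonneg hθ h.nonneg)
      linarith
    · rw [← Real.exp_nat_mul, ← Real.exp_add, hτ]
      congr 2
      ring
  have hmeas : MeasurableSet {x : Fin n → Config p | SDPRecovers S x} :=
    (Set.toFinite _).measurableSet
  have h1 := measureReal_mono (μ := P) hcover (measure_ne_top _ _)
  rw [probReal_compl_eq_one_sub hmeas] at h1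
  have h2 := measureReal_union_le (μ := P) (⋃ i, D i) A
  linarith

end sample

/-! ### The contrast at low temperature -/

theorem one_add_sq_div_two_le_cosh (x : ℝ) : 1 + x ^ 2 / 2 ≤ Real.cosh x := by
  have h1 : |x / 2| ≤ |Real.sinh (x / 2)| := by
    rw [Real.abs_sinh]
    exact Real.self_le_sinh_iff.2 (abs_nonneg _)
  have h2 := sq_le_sq.2 h1
  have h3 := Real.cosh_two_mul (x / 2)
  have h4 := Real.cosh_sq (x / 2)
  rw [mul_div_cancel₀ x (by norm_num : (2 : ℝ) ≠ 0)] at h3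
  linarith

section lowTemperature

variable {p : ℕ} {S : Finset (Fin p)} {α β : ℝ}

/-- Flipping the spins outside `S` exchanges the magnetization and the block contrast. For `α ≤ 0`
the model favours the contrast. -/
theorem expect_magnetization_sq_le (hα : α ≤ 0) :
    expect S α β (fun σ => magnetization σ ^ 2) ≤ expect S α β (fun σ => contrast S σ ^ 2) := by
  let ρ : Config p → Config p := fun σ i => if i ∈ S then σ i else -σ i
  have hρ : Function.Involutive ρ := by
    intro σ
    ext i
    simp only [ρ]
    split_ifs <;> simp
  have hspin : ∀ σ i, spin (ρ σ) i = blockVec S i * spin σ i := by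
    intro σ i
    simp only [spin, ρ, blockVec]
    split_ifs <;> simp
  have hM : ∀ σ, magnetization (ρ σ) = contrast S σ := by
    intro σ
    simp only [magnetization, contrast, hspin]
  have hw : ∀ σ, contrast S (ρ σ) = magnetization σ := by
    intro σ
    simp only [magnetization, contrast, hspin, ← mul_assoc, blockVec_mul_self, one_mul]
  rw [← sub_nonneg, ← expect_sub]
  have h1 : expect S α β (fun σ => contrast S σ ^ 2 - magnetization σ ^ 2) =
      ∑ σ, density S α β (ρ σ) * (magnetization σ ^ 2 - contrast S σ ^ 2) := by
    rw [expect, ← Equiv.sum_comp hρ.toPerm]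
    refine Finset.sum_congr rfl fun σ _ => ?_
    change density S α β (ρ σ) * (contrast S (ρ σ) ^ 2 - magnetization (ρ σ) ^ 2) = _
    rw [hM, hw]
  have h2 : 0 ≤ ∑ σ, (density S α β σ * (contrast S σ ^ 2 - magnetization σ ^ 2) +
      density S α β (ρ σ) * (magnetization σ ^ 2 - contrast S σ ^ 2)) := by
    refine Finset.sum_nonneg fun σ _ => ?_
    have hexp : exponent S α β σ - exponent S α β (ρ σ) =
        -α / (2 * p) * (contrast S σ ^ 2 - magnetization σ ^ 2) := by
      rw [exponent_eq, exponent_eq, hM, hw]; ring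
    have hc : 0 ≤ -α / (2 * (p : ℝ)) := div_nonneg (by linarith) (by positivity)
    have hZ := partitionFunction_pos S α β
    rcases le_total (magnetization σ ^ 2) (contrast S σ ^ 2) with hle | hle
    · have : density S α β (ρ σ) ≤ density S α β σ := by
        refine div_le_div_of_nonneg_right (Real.exp_le_exp.2 ?_) hZ.le
        have := mul_nonneg hc (sub_nonneg.2 hle)
        linarith
      nlinarith
    · have : density S α β σ ≤ density S α β (ρ σ) := by
        refine div_le_div_of_nonneg_right (Real.exp_le_exp.2 ?_) hZ.le
        have := mul_nonneg hc (sub_nonneg.2 hle)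
        linarith
      nlinarith
  rw [Finset.sum_add_distrib, ← h1] at h2
  have h3 : ∑ σ, density S α β σ * (contrast S σ ^ 2 - magnetization σ ^ 2) =
      expect S α β (fun σ => contrast S σ ^ 2 - magnetization σ ^ 2) := rfl
  linarith

/-- The free energy is at most the energy plus the maximal entropy. -/
theorem partitionFunction_le (S : Finset (Fin p)) (α β : ℝ) :
    partitionFunction S α β ≤ 2 ^ p * Real.exp (expect S α β (exponent S α β)) := by
  have hZ := partitionFunction_pos S α β
  set e := expect S α β (exponent S α β) with he
  have h1 : expect S α β (fun σ => Real.exp (-exponent S α β σ)) =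
      2 ^ p / partitionFunction S α β := by
    have : ∀ σ, density S α β σ * Real.exp (-exponent S α β σ) = 1 / partitionFunction S α β := by
      intro σ
      rw [density, div_mul_eq_mul_div, ← Real.exp_add, add_neg_cancel, Real.exp_zero]
    rw [expect, Finset.sum_congr rfl fun σ _ => this σ]
    simp [Fintype.card_units_int, div_eq_mul_inv]
  have h2 : Real.exp (-e) ≤ expect S α β (fun σ => Real.exp (-exponent S α β σ)) := by
    have hpt : ∀ σ, Real.exp (-e) * (1 + e - exponent S α β σ) ≤
        Real.exp (-exponent S α β σ) := by
      intro σ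
      have := Real.add_one_le_exp (e - exponent S α β σ)
      calc _ ≤ Real.exp (-e) * Real.exp (e - exponent S α β σ) :=
            mul_le_mul_of_nonneg_left (by linarith) (Real.exp_pos _).le
        _ = _ := by rw [← Real.exp_add]; congr 1; ring
    refine le_trans (le_of_eq ?_) (expect_mono hpt)
    rw [expect_const_mul, expect_sub, expect_const, ← he]
    ring
  rw [h1, le_div_iff₀ hZ, Real.exp_neg, inv_mul_le_iff₀ (Real.exp_pos _)] at h2
  linarith

theorem sum_exp_linear (a : Fin p → ℝ) :
    ∑ σ : Config p, Real.exp (∑ i, a i * spin σ i) = ∏ i, (2 * Real.cosh (a i)) := by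
  have h : ∀ i, 2 * Real.cosh (a i) = ∑ u : ℤˣ, Real.exp (a i * ((u : ℤ) : ℝ)) := by
    intro i
    rw [UnitsInt.univ, Finset.sum_pair (by decide), Real.cosh_eq]
    simp
    ring
  simp only [h]
  rw [Finset.prod_univ_sum, Fintype.piFinset_univ]
  refine Finset.sum_congr rfl fun σ _ => ?_
  rw [Real.exp_sum]
  rfl

theorem sum_exp_contrast (S : Finset (Fin p)) (h : ℝ) :
    ∑ σ : Config p, Real.exp (h * contrast S σ) = (2 * Real.cosh h) ^ p := by
  have := sum_exp_linear fun i => h * blockVec S i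
  have e : ∀ i, Real.cosh (h * blockVec S i) = Real.cosh h := by
    intro i
    rcases blockVec_eq_or S i with hi | hi <;> simp [hi]
  simp only [e, mul_assoc, ← Finset.mul_sum] at this
  simpa [contrast] using this

theorem sum_exp_contrast_add_magnetization_le (hS : 2 * S.card = p) (h s : ℝ) :
    ∑ σ : Config p, Real.exp (h * contrast S σ + s * magnetization σ) ≤
      (2 * Real.cosh h) ^ p * Real.exp (p * s ^ 2 / 2) := by
  have hc : Sᶜ.card = S.card := by
    rw [Finset.card_compl, Fintype.card_fin]; omega
  have e1 : ∀ σ : Config p, h * contrast S σ + s * magnetization σ =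
      ∑ i, (h * blockVec S i + s) * spin σ i := by
    intro σ
    simp only [contrast, magnetization, Finset.mul_sum, ← Finset.sum_add_distrib]
    exact Finset.sum_congr rfl fun i _ => by ring
  simp only [e1]
  rw [sum_exp_linear, ← Finset.prod_mul_prod_compl S]
  have p1 : ∏ i ∈ S, 2 * Real.cosh (h * blockVec S i + s) = (2 * Real.cosh (h + s)) ^ S.card := by
    rw [Finset.prod_congr rfl fun i hi => by rw [show blockVec S i = 1 by simp [blockVec, hi]],
      Finset.prod_const, mul_one]
  have p2 : ∏ i ∈ Sᶜ, 2 * Real.cosh (h * blockVec S i + s) = (2 * Real.cosh (h - s)) ^ S.card := by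
    rw [Finset.prod_congr rfl fun i hi => by
      rw [show blockVec S i = -1 by simp [blockVec, Finset.mem_compl.1 hi]],
      Finset.prod_const, hc, show h * -1 + s = -(h - s) by ring, Real.cosh_neg]
  rw [p1, p2, ← mul_pow]
  have key : 2 * Real.cosh (h + s) * (2 * Real.cosh (h - s)) ≤
      (2 * Real.cosh h) ^ 2 * Real.exp (s ^ 2) := by
    have hs : Real.cosh s ^ 2 ≤ Real.exp (s ^ 2) := by
      calc _ ≤ Real.exp (s ^ 2 / 2) ^ 2 :=
            pow_le_pow_left₀ (Real.cosh_pos s).le (Real.cosh_le_exp_half_sq s) 2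
        _ = _ := by rw [← Real.exp_nat_mul]; congr 1; push_cast; ring
    have h1 := mul_le_mul_of_nonneg_left hs (sq_nonneg (2 * Real.cosh h))
    rw [Real.cosh_add, Real.cosh_sub]
    nlinarith [sq_nonneg (Real.sinh h * Real.sinh s)]
  have hpow := pow_le_pow_left₀ (by have := Real.cosh_pos (h + s); have := Real.cosh_pos (h - s)
                                    positivity) key S.card
  refine hpow.trans (le_of_eq ?_)
  rw [mul_pow, ← pow_mul, hS, ← Real.exp_nat_mul]
  congr 2
  have : (p : ℝ) = 2 * S.card := by exact_mod_cast hS.symm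
  rw [this]; ring

/-- Under the product measure tilted towards the contrast, the magnetization has variance of
order `p`. -/
theorem sum_exp_contrast_mul_magnetization_sq_le (hp : 0 < p) (hS : 2 * S.card = p) (h : ℝ) :
    ∑ σ : Config p, Real.exp (h * contrast S σ) * magnetization σ ^ 2 ≤
      2 * p * (2 * Real.cosh h) ^ p := by
  have hp' : (0 : ℝ) < p := by positivity
  -- `M² ≤ p (2 cosh (s M) - 2)`, and at this `s` the cost `exp (p s² / 2)` is bounded.
  set s := 1 / √(p : ℝ) with hs
  have hs2 : s ^ 2 = 1 / p := by rw [hs, div_pow, one_pow, Real.sq_sqrt hp'.le]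
  have hsp : p * s ^ 2 = 1 := by rw [hs2]; field_simp
  have hpt : ∀ σ : Config p, Real.exp (h * contrast S σ) * magnetization σ ^ 2 ≤
      p * (Real.exp (h * contrast S σ + s * magnetization σ) +
        Real.exp (h * contrast S σ + -s * magnetization σ) - 2 * Real.exp (h * contrast S σ)) := by
    intro σ
    have h1 := one_add_sq_div_two_le_cosh (s * magnetization σ)
    have h2 : magnetization σ ^ 2 ≤ p * (2 * Real.cosh (s * magnetization σ) - 2) := by
      have : p * (s * magnetization σ) ^ 2 = magnetization σ ^ 2 := by
        rw [mul_pow, ← mul_assoc, hsp, one_mul]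
      nlinarith
    have h3 := mul_le_mul_of_nonneg_left h2 (Real.exp_pos (h * contrast S σ)).le
    refine h3.trans (le_of_eq ?_)
    rw [Real.cosh_eq, Real.exp_add, Real.exp_add, neg_mul]
    ring
  refine (Finset.sum_le_sum fun σ _ => hpt σ).trans ?_
  rw [← Finset.mul_sum, Finset.sum_sub_distrib, Finset.sum_add_distrib, ← Finset.mul_sum,
    sum_exp_contrast]
  have k1 := sum_exp_contrast_add_magnetization_le hS h s
  have k2 := sum_exp_contrast_add_magnetization_le hS h (-s)
  rw [neg_sq] at k2
  rw [hsp] at k1 k2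
  have hZ : 0 < (2 * Real.cosh h) ^ p := by have := Real.cosh_pos h; positivity
  have he : Real.exp (1 / 2) ≤ 2 := by
    have h1 : Real.exp (1 / 2) ^ 2 = Real.exp 1 := by
      rw [← Real.exp_nat_mul]; norm_num
    have := Real.exp_one_lt_d9
    nlinarith [Real.exp_pos (1 / 2)]
  have h5 := mul_le_mul_of_nonneg_left he hZ.le
  nlinarith

/-- Lower bound on the partition function from the mean-field trial state with external field
`h v`. -/
theorem partitionFunction_ge (hp : 0 < p) (hS : 2 * S.card = p) (hαβ : α < β) (h : ℝ) :
    Real.exp (-(p * (h ^ 2 / (β - α))) - |β + α| / 2) * (2 * Real.cosh h) ^ p ≤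
      partitionFunction S α β := by
  have hp' : (0 : ℝ) < p := by positivity
  have hb : 0 < β - α := sub_pos.2 hαβ
  set a := |β + α| / 2 with ha
  have hpt : ∀ σ, Real.exp (-(p * (h ^ 2 / (β - α))) - a) * ((1 + a) *
      Real.exp (h * contrast S σ) - a / (2 * p) *
        (Real.exp (h * contrast S σ) * magnetization σ ^ 2)) ≤ Real.exp (exponent S α β σ) := by
    intro σ
    -- Linearization of the square: the gap is `(β - α) / (4 p)` times a square.
    have h1 : h * contrast S σ - p * (h ^ 2 / (β - α)) ≤
        (β - α) / (4 * p) * contrast S σ ^ 2 := by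
      have : (β - α) / (4 * p) * contrast S σ ^ 2 - (h * contrast S σ - p * (h ^ 2 / (β - α))) =
          (β - α) / (4 * p) * (contrast S σ - 2 * p * h / (β - α)) ^ 2 := by
        field_simp; ring
      have h0 : 0 ≤ (β - α) / (4 * p) * (contrast S σ - 2 * p * h / (β - α)) ^ 2 := by positivity
      linarith
    have h2 : -(a / (2 * p) * magnetization σ ^ 2) ≤
        (β + α) / (4 * p) * magnetization σ ^ 2 := by
      have h3 : -a / (2 * p) ≤ (β + α) / (4 * p) := by
        rw [div_le_div_iff₀ (by positivity) (by positivity), ha]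
        nlinarith [neg_abs_le (β + α)]
      have := mul_le_mul_of_nonneg_right h3 (sq_nonneg (magnetization σ))
      rw [neg_div, neg_mul] at this
      exact this
    have h4 := Real.add_one_le_exp (a - a / (2 * p) * magnetization σ ^ 2)
    have h5 := mul_le_mul_of_nonneg_left h4
      (Real.exp_pos (h * contrast S σ - p * (h ^ 2 / (β - α)) - a)).le
    rw [← Real.exp_add] at h5
    have h6 : Real.exp (-(p * (h ^ 2 / (β - α))) - a) * Real.exp (h * contrast S σ) =
        Real.exp (h * contrast S σ - p * (h ^ 2 / (β - α)) - a) := by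
      rw [← Real.exp_add]; congr 1; ring
    calc _ = Real.exp (-(p * (h ^ 2 / (β - α))) - a) * Real.exp (h * contrast S σ) *
          (a - a / (2 * p) * magnetization σ ^ 2 + 1) := by ring
      _ ≤ _ := by
          rw [h6]
          refine h5.trans (Real.exp_le_exp.2 ?_)
          rw [exponent_eq]
          linarith
  refine le_trans ?_ (Finset.sum_le_sum fun σ _ => hpt σ)
  rw [← Finset.mul_sum, Finset.sum_sub_distrib, ← Finset.mul_sum, ← Finset.mul_sum,
    sum_exp_contrast]
  refine mul_le_mul_of_nonneg_left ?_ (Real.exp_pos _).le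
  have h7 := mul_le_mul_of_nonneg_left (sum_exp_contrast_mul_magnetization_sq_le hp hS h)
    (by positivity : 0 ≤ a / (2 * p))
  have h8 : a / (2 * p) * (2 * p * (2 * Real.cosh h) ^ p) = a * (2 * Real.cosh h) ^ p := by
    field_simp
  linarith

end lowTemperature

/-- Below the critical temperature, and for `α ≤ 0`, the block contrast is of order `p`: the free
energy exceeds the maximal entropy by order `p`, so the energy is of order `p`, and the energy is
controlled by the contrast. -/
theorem exists_mul_sq_le_expect_contrast_sq {α β : ℝ} (hα : α ≤ 0) (hb : 2 < β - α) :
    ∃ c p₀ : ℝ, 0 < c ∧ ∀ p : ℕ, 0 < p → p₀ ≤ p → ∀ S : Finset (Fin p), 2 * S.card = p →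
      c * p ^ 2 ≤ expect S α β (fun σ => contrast S σ ^ 2) := by
  set b := β - α with hbdef
  set a := |β + α| / 2 with ha
  have ha0 : 0 ≤ a := by positivity
  -- Any field with `0 < h ^ 2 < b - 2` would do.
  set h := √((b - 2) / 2) with hh
  have hh2 : h ^ 2 = (b - 2) / 2 := Real.sq_sqrt (by linarith)
  -- The gain in free energy per site of the trial state over the uniform distribution.
  set γ := h ^ 2 / (2 + h ^ 2) - h ^ 2 / b with hγ
  have hγ0 : 0 < γ := by
    have h1 : 0 < h ^ 2 := by rw [hh2]; linarith
    rw [hγ, sub_pos]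
    exact div_lt_div_of_pos_left h1 (by linarith) (by rw [hh2]; linarith)
  refine ⟨2 * γ / (b + |β + α|), 2 * a / γ, by positivity, fun p hp hp₀ S hS => ?_⟩
  have hp' : (0 : ℝ) < p := by positivity
  have hZ1 := partitionFunction_ge (S := S) (α := α) (β := β) hp hS (by linarith) h
  have hZ2 := partitionFunction_le S α β
  set e := expect S α β (exponent S α β) with he
  have hcosh : Real.exp (p * (h ^ 2 / (2 + h ^ 2))) ≤ Real.cosh h ^ p := by
    rw [Real.exp_nat_mul]
    refine pow_le_pow_left₀ (Real.exp_pos _).le (le_trans ?_ (one_add_sq_div_two_le_cosh h)) p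
    have hpos : 0 < 1 + h ^ 2 / 2 := by positivity
    rw [← Real.le_log_iff_exp_le hpos]
    refine le_trans (le_of_eq ?_) (Real.one_sub_inv_le_log_of_pos hpos)
    field_simp
    ring
  have hfree : p * γ - a ≤ e := by
    have h2p : (0 : ℝ) < 2 ^ p := by positivity
    have h1 : 2 ^ p * Real.exp (p * γ - a) ≤ 2 ^ p * Real.exp e := by
      refine le_trans ?_ (hZ1.trans hZ2)
      rw [mul_pow]
      have h2 := mul_le_mul_of_nonneg_left hcosh
        (Real.exp_pos (-(p * (h ^ 2 / b)) - a)).le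
      rw [← Real.exp_add] at h2
      have h3 : -(p * (h ^ 2 / b)) - a + p * (h ^ 2 / (2 + h ^ 2)) = p * γ - a := by
        rw [hγ]; ring
      rw [h3] at h2
      calc _ ≤ 2 ^ p * (Real.exp (-(p * (h ^ 2 / b)) - a) * Real.cosh h ^ p) :=
            mul_le_mul_of_nonneg_left h2 h2p.le
        _ = _ := by ring
    exact Real.exp_le_exp.1 (le_of_mul_le_mul_left h1 h2p)
  have henergy : e ≤ (b + |β + α|) / (4 * p) * expect S α β (fun σ => contrast S σ ^ 2) := by
    have hpt : ∀ σ, exponent S α β σ ≤ |β + α| / (4 * p) * magnetization σ ^ 2 +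
        b / (4 * p) * contrast S σ ^ 2 := by
      intro σ
      rw [exponent_eq]
      gcongr
      exact le_abs_self _
    have h1 := expect_mono (S := S) (α := α) (β := β) hpt
    rw [expect_add, expect_const_mul, expect_const_mul] at h1
    have h2 := mul_le_mul_of_nonneg_left (expect_magnetization_sq_le (S := S) (β := β) hα)
      (by positivity : 0 ≤ |β + α| / (4 * (p : ℝ)))
    calc e ≤ _ := h1
      _ ≤ |β + α| / (4 * p) * expect S α β (fun σ => contrast S σ ^ 2) +
          b / (4 * p) * expect S α β (fun σ => contrast S σ ^ 2) := by linarith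
      _ = _ := by ring
  have hpγ : p * γ / 2 ≤ p * γ - a := by
    rw [div_le_iff₀ hγ0] at hp₀; linarith
  have h9 := hpγ.trans (hfree.trans henergy)
  have hbb : 0 < b + |β + α| := by positivity
  have h10 : 2 * γ / (b + |β + α|) * p ^ 2 = (p * γ / 2) * (4 * p / (b + |β + α|)) := by
    field_simp; ring
  rw [h10]
  refine (mul_le_mul_of_nonneg_right h9 (by positivity)).trans (le_of_eq ?_)
  field_simp

/-! ### Sample complexity -/

theorem log_two_le_log_div {p : ℕ} (hp : 2 ≤ p) {δ : ℝ} (hδ : 0 < δ) (hδ1 : δ < 1) :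
    Real.log 2 ≤ Real.log (p / δ) := by
  have hp' : (2 : ℝ) ≤ p := by exact_mod_cast hp
  refine Real.log_le_log (by norm_num) ?_
  rw [le_div_iff₀ hδ]
  linarith

theorem failure_bound_le {p : ℕ} (hp : 2 ≤ p) {δ ρ A B : ℝ} (hδ : 0 < δ) (hδ1 : δ < 1) (hρ : 0 < ρ)
    (hA : 2 * Real.log (p / δ) ≤ A) (hB : p * Real.log ρ + 2 * Real.log (p / δ) ≤ B) :
    p * Real.exp (-A) + ρ ^ p * Real.exp (-B) ≤ δ := by
  have hp' : (2 : ℝ) ≤ p := by exact_mod_cast hp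
  have hp0 : (0 : ℝ) < p := by linarith
  have hexp : Real.exp (-(2 * Real.log (p / δ))) = (δ / p) ^ 2 := by
    rw [show -(2 * Real.log (p / δ)) = (2 : ℕ) * -Real.log (p / δ) by push_cast; ring,
      Real.exp_nat_mul, Real.exp_neg, Real.exp_log (by positivity), inv_div]
  have h1 : p * Real.exp (-A) ≤ δ / 2 := by
    calc p * Real.exp (-A) ≤ p * (δ / p) ^ 2 := by
          rw [← hexp]
          exact mul_le_mul_of_nonneg_left (Real.exp_le_exp.2 (by linarith)) hp0.le
      _ = δ ^ 2 / p := by field_simp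
      _ ≤ δ / 2 := by rw [div_le_div_iff₀ hp0 two_pos]; nlinarith
  have h2 : ρ ^ p * Real.exp (-B) ≤ δ / 2 := by
    have hρp : ρ ^ p = Real.exp (p * Real.log ρ) := by
      rw [Real.exp_nat_mul, Real.exp_log hρ]
    calc ρ ^ p * Real.exp (-B) ≤ (δ / p) ^ 2 := by
          rw [← hexp, hρp, ← Real.exp_add, Real.exp_le_exp]; linarith
      _ ≤ δ / 2 := by
          rw [div_pow, div_le_div_iff₀ (by positivity) two_pos]
          have h3 : δ ^ 2 ≤ δ := by nlinarith
          have h4 : (2 : ℝ) ≤ p ^ 2 := by nlinarith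
          have h5 := mul_le_mul_of_nonneg_left h4 hδ.le
          linarith
  linarith

/-- For all `α < β`, order `p log (p / δ)` observations suffice. -/
theorem exists_sdpRecovers_of_mul_log_le {α β : ℝ} (hαβ : α < β) :
    ∃ C : ℝ, 0 < C ∧ ∀ p : ℕ, 2 ≤ p → ∀ S : Finset (Fin p), 2 * S.card = p →
      ∀ δ : ℝ, 0 < δ → δ < 1 → ∀ n : ℕ, C * p * Real.log (p / δ) ≤ n →
        1 - δ ≤ (sampleLaw n S α β).real {x | SDPRecovers S x} := by
  set c := min (gapConst α β) 1 with hc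
  have hc0 : 0 < c := lt_min (gapConst_pos hαβ) one_pos
  have hc1 : c ≤ 1 := min_le_right _ _
  -- The gap `c` between the mean `s + p g ≥ s + c` of the certificate entries and the variance `s`
  -- of the residuals is shared among the fluctuations of both and the radius of the averaging ball.
  set ε := c / 8 with hε
  set r := c / 48 with hr
  set θ := c / 524288 with hθ
  set ρ := (1 + r) / r with hρ
  have hr0 : 0 < r := by positivity
  have hρ0 : 0 < ρ := by positivity
  have hρ1 : 0 ≤ Real.log ρ := Real.log_nonneg (by rw [hρ, le_div_iff₀ hr0]; linarith)
  have hlog2 : 0 < Real.log 2 := Real.log_pos (by norm_num)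
  set C₁ := 32 / (c * ε ^ 2) with hC₁
  set C₂ := (2 + Real.log ρ / Real.log 2) * (4 / (θ * c)) with hC₂
  have hC₁0 : 0 < C₁ := by positivity
  have hC₂0 : 0 < C₂ := by positivity
  refine ⟨C₁ + C₂, by positivity, fun p hp S hS δ hδ hδ1 n hn => ?_⟩
  have hp0 : 0 < p := by omega
  have hp' : (0 : ℝ) < p := by positivity
  have hL := log_two_le_log_div hp hδ hδ1
  set L := Real.log (p / δ)
  have hL0 : 0 < L := hlog2.trans_le hL
  have hn0 : 0 < n := by
    have : (0 : ℝ) < n := lt_of_lt_of_le (by positivity) hn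
    exact_mod_cast this
  obtain ⟨s, η, g, h, hgap⟩ := exists_isCovariance hp0 hS hαβ
  have hcg : c ≤ p * g := (min_le_left _ _).trans hgap
  have hg : 0 ≤ g := by
    by_contra hneg
    nlinarith [mul_pos hp' (neg_pos.2 (not_le.1 hneg))]
  have hs0 := h.nonneg
  have hs2 := h.le_two
  have hT : s + c / 2 ≤ (1 - ε) * (s + p * g) := by
    have h1 : (1 - ε) * (s + c) ≤ (1 - ε) * (s + p * g) :=
      mul_le_mul_of_nonneg_left (by linarith) (by rw [hε]; linarith)
    rw [hε] at h1 ⊢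
    nlinarith
  have key := sampleLaw_sdpRecovers_ge h hp0 hS hg hn0 (ε := ε) (θ := θ) (r := r) (T := s + c / 2)
    (by positivity) (by rw [hε]; linarith) (by positivity) (by rw [hθ]; linarith) hr0
    (by rw [hr]; linarith) hT
  refine le_trans ?_ key
  have hA : 2 * L ≤ n * ((s + p * g) * ε ^ 2 / (16 * p)) := by
    have h1 : C₁ * p * L ≤ n := by nlinarith [mul_pos (mul_pos hC₂0 hp') hL0]
    have h2 : c * ε ^ 2 / (16 * p) ≤ (s + p * g) * ε ^ 2 / (16 * p) := by
      gcongr; linarith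
    calc 2 * L = C₁ * p * L * (c * ε ^ 2 / (16 * p)) := by
          rw [hC₁]
          have : ε ≠ 0 := by positivity
          field_simp; ring
      _ ≤ n * ((s + p * g) * ε ^ 2 / (16 * p)) := mul_le_mul h1 h2 (by positivity) (by positivity)
  have hB : p * Real.log ρ + 2 * L ≤ n * (θ * (s + c / 2 - s * (1 + r) ^ 2 - 65536 * θ)) := by
    have h1 : C₂ * p * L ≤ n := by nlinarith [mul_pos (mul_pos hC₁0 hp') hL0]
    have h2 : c / 4 ≤ s + c / 2 - s * (1 + r) ^ 2 - 65536 * θ := by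
      have hr1 : r ≤ 1 := by rw [hr]; linarith
      have h3 : (1 + r) ^ 2 ≤ 1 + 3 * r := by nlinarith
      have h4 := mul_le_mul_of_nonneg_left h3 hs0
      have h5 := mul_le_mul_of_nonneg_right hs2 hr0.le
      have h6 : 6 * r = c / 8 := by rw [hr]; ring
      have h7 : 65536 * θ = c / 8 := by rw [hθ]; ring
      linarith
    have h8 : C₂ * p * L * (θ * (c / 4)) = 2 * (p * L) + p * (Real.log ρ * (L / Real.log 2)) := by
      rw [hC₂]
      have : θ ≠ 0 := by positivity
      field_simp
    have h9 : Real.log ρ ≤ Real.log ρ * (L / Real.log 2) :=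
      le_mul_of_one_le_right hρ1 ((one_le_div hlog2).2 hL)
    have h10 := mul_le_mul_of_nonneg_left h9 hp'.le
    have h11 : L ≤ p * L := le_mul_of_one_le_left hL0.le (by exact_mod_cast hp0)
    calc _ ≤ C₂ * p * L * (θ * (c / 4)) := by rw [h8]; linarith
      _ ≤ _ := mul_le_mul h1 (mul_le_mul_of_nonneg_left h2 (by positivity)) (by positivity)
          (by positivity)
  have := failure_bound_le hp hδ hδ1 hρ0 hA hB
  linarith

/-- Below the critical temperature, and for `α ≤ 0`, order `log (p / δ)` observations suffice. -/
theorem exists_sdpRecovers_of_log_le {α β : ℝ} (hα : α ≤ 0) (hb : 2 < β - α) :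
    ∃ C : ℝ, 0 < C ∧ ∀ p : ℕ, 2 ≤ p → ∀ S : Finset (Fin p), 2 * S.card = p →
      ∀ δ : ℝ, 0 < δ → δ < 1 → ∀ n : ℕ, C * Real.log (p / δ) ≤ n →
        1 - δ ≤ (sampleLaw n S α β).real {x | SDPRecovers S x} := by
  have hαβ : α < β := by linarith
  obtain ⟨C₁, hC₁, hcase1⟩ := exists_sdpRecovers_of_mul_log_le hαβ
  obtain ⟨c, p₀, hc, hcase2⟩ := exists_mul_sq_le_expect_contrast_sq hα hb
  have hlog2 : 0 < Real.log 2 := Real.log_pos (by norm_num)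
  set p₁ := max p₀ (2080 / c) with hp₁
  have hp₁0 : 0 < p₁ := lt_max_of_lt_right (by positivity)
  refine ⟨1536 / c + C₁ * p₁, by positivity, fun p hp S hS δ hδ hδ1 n hn => ?_⟩
  have hp0 : 0 < p := by omega
  have hp' : (0 : ℝ) < p := by positivity
  have hL := log_two_le_log_div hp hδ hδ1
  have hL0 : 0 < Real.log (p / δ) := hlog2.trans_le hL
  -- In bounded dimension the bound of order `p log (p / δ)` is of the required order.
  rcases le_total (p : ℝ) p₁ with hsmall | hlarge
  · refine hcase1 p hp S hS δ hδ hδ1 n (le_trans ?_ hn)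
    have h1 : C₁ * p ≤ 1536 / c + C₁ * p₁ := by
      have : 0 < 1536 / c := by positivity
      nlinarith
    exact mul_le_mul_of_nonneg_right h1 hL0.le
  set L := Real.log (p / δ)
  have hn0 : 0 < n := by
    have : (0 : ℝ) < n := lt_of_lt_of_le (by positivity) hn
    exact_mod_cast this
  have hnC : 1536 / c * L ≤ n := by nlinarith [mul_pos (mul_pos hC₁ hp₁0) hL0]
  obtain ⟨s, η, g, h, hgap⟩ := exists_isCovariance hp0 hS hαβ
  have hg : 0 ≤ g := by
    by_contra hneg
    nlinarith [mul_pos hp' (neg_pos.2 (not_le.1 hneg)), gapConst_pos hαβ]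
  have hμ : c * p ≤ s + p * g := by
    have h1 := hcase2 p hp0 ((le_max_left _ _).trans hlarge) S hS
    rw [h.expect_contrast_sq hS] at h1
    have h2 : p * (c * p) ≤ p * (s + p * g) := by linarith
    exact le_of_mul_le_mul_left h2 hp'
  have hpc : 2080 ≤ c * p := by
    have := (le_max_right p₀ (2080 / c)).trans hlarge
    rw [div_le_iff₀ hc] at this
    linarith
  have key := sampleLaw_sdpRecovers_ge h hp0 hS hg hn0 (ε := 1 / 2) (θ := 1 / 128) (r := 1)
    (T := c * p / 2) (by norm_num) (by norm_num) (by norm_num) le_rfl one_pos le_rfl (by linarith)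
  refine le_trans ?_ key
  have hA : 2 * L ≤ n * ((s + p * g) * (1 / 2) ^ 2 / (16 * p)) := by
    have h2 : c / 64 ≤ (s + p * g) * (1 / 2) ^ 2 / (16 * p) := by
      rw [div_le_div_iff₀ (by norm_num) (by positivity)]
      linarith
    calc 2 * L ≤ 1536 / c * L * (c / 64) := by
          have : 1536 / c * L * (c / 64) = 24 * L := by field_simp; ring
          linarith
      _ ≤ _ := mul_le_mul hnC h2 (by positivity) (by positivity)
  have hB : p * Real.log ((1 + 1) / 1) + 2 * L ≤
      n * (1 / 128 * (c * p / 2 - s * (1 + 1) ^ 2 - 65536 * (1 / 128))) := by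
    have h2 : c * p / 4 ≤ c * p / 2 - s * (1 + 1) ^ 2 - 65536 * (1 / 128) := by
      have := h.le_two
      linarith
    have h3 : 1536 / c * L * (1 / 128 * (c * p / 4)) = 3 * (p * L) := by field_simp; ring
    have h4 : L ≤ p * L := le_mul_of_one_le_left hL0.le (by exact_mod_cast hp0)
    have h5 := mul_le_mul_of_nonneg_left hL hp'.le
    rw [show ((1 : ℝ) + 1) / 1 = 2 by norm_num]
    calc _ ≤ 1536 / c * L * (1 / 128 * (c * p / 4)) := by rw [h3]; linarith
      _ ≤ _ := mul_le_mul hnC (mul_le_mul_of_nonneg_left h2 (by norm_num)) (by positivity)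
          (by positivity)
  have := failure_bound_le hp hδ hδ1 (by norm_num : (0 : ℝ) < (1 + 1) / 1) hA hB
  linarith

end IsingBlock

theorem mainTheorem3 (α β : ℝ) (hαβ : α < β) :
    ∃ C₁ C₂ : ℝ, 0 < C₁ ∧ 0 < C₂ ∧
      ∀ (p : ℕ), 2 ≤ p → Even p → ∀ (S : Finset (Fin p)), S.card = p / 2 →
      ∀ (δ : ℝ), 0 < δ → δ < 1 → ∀ (n : ℕ),
        ((β + |α| < 2 ∨ 0 < α) → C₁ * p * Real.log (p / δ) ≤ n →
          1 - δ ≤ (IsingBlock.sampleLaw n S α β).real {x | IsingBlock.SDPRecovers S x}) ∧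
        (¬ (β + |α| < 2 ∨ 0 < α) → β + |α| ≠ 2 → C₂ * Real.log (p / δ) ≤ n →
          1 - δ ≤ (IsingBlock.sampleLaw n S α β).real {x | IsingBlock.SDPRecovers S x}) ∧
        (2 < β - α → α ≤ 0 → C₂ * Real.log (p / δ) ≤ n →
          1 - δ ≤ (IsingBlock.sampleLaw n S α β).real {x | IsingBlock.SDPRecovers S x}) := by
  obtain ⟨C₁, hC₁, h₁⟩ := IsingBlock.exists_sdpRecovers_of_mul_log_le hαβ
  obtain ⟨C₂, hC₂, h₂⟩ : ∃ C₂ : ℝ, 0 < C₂ ∧ (α ≤ 0 → 2 < β - α → ∀ p : ℕ, 2 ≤ p →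
      ∀ S : Finset (Fin p), 2 * S.card = p → ∀ δ : ℝ, 0 < δ → δ < 1 → ∀ n : ℕ,
        C₂ * Real.log (p / δ) ≤ n →
          1 - δ ≤ (IsingBlock.sampleLaw n S α β).real {x | IsingBlock.SDPRecovers S x}) := by
    by_cases h : α ≤ 0 ∧ 2 < β - α
    · obtain ⟨C₂, hC₂, h₂⟩ := IsingBlock.exists_sdpRecovers_of_log_le h.1 h.2
      exact ⟨C₂, hC₂, fun _ _ => h₂⟩
    · exact ⟨1, one_pos, fun ha hb => absurd ⟨ha, hb⟩ h⟩
  refine ⟨C₁, C₂, hC₁, hC₂, fun p hp heven S hcard δ hδ hδ1 n => ?_⟩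
  have hS : 2 * S.card = p := by
    rw [hcard]
    exact Nat.two_mul_div_two_of_even heven
  refine ⟨fun _ => h₁ p hp S hS δ hδ hδ1 n, fun hnot hne => ?_,
    fun hb ha => h₂ ha hb p hp S hS δ hδ hδ1 n⟩
  rw [not_or, not_lt, not_lt] at hnot
  have habs : |α| = -α := abs_of_nonpos hnot.2
  have hb : 2 < β - α := by
    have := lt_of_le_of_ne hnot.1 hne.symm
    rw [habs] at this
    linarith
  exact h₂ hnot.2 hb p hp S hS δ hδ hδ1 n
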